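/- Let $\Omega\subset\mathbb R^2$ be a connected open set (a domain) that is divided into non-overlapping rectangles by a rectangular mesh: there are node vectors $x_0<\dots<x_{n_1}$ and $y_0<\dots<y_{n_2}$ such that, with $K_{i,j}=[x_{i-1},x_i]\times[y_{j-1},y_j]$ and $\mathcal T_h=\{K_{i,j}:K_{i,j}\subset\overline\Omega\}$, one has $\overline\Omega=\bigcup_{K\in\mathcal T_h}K$ and the interior of each $K\in\mathcal T_h$ lies in $\Omega$. Put $h_{x_i}=x_i-x_{i-1}$, $h_{y_j}=y_j-y_{j-1}$, and let $h$ be the largest side length of the rectangles in $\mathcal T_h$. Let $$\boldsymbol\Sigma_h=\{\boldsymbol\tau\in \boldsymbol H(\operatorname{div},\Omega):\ \boldsymbol\tau|_K\in \operatorname{span}\{1,x\}\times\operatorname{span}\{1,y\}\ \ \forall K\in\mathcal T_h\}$$ be the lowest-order rectangular Raviart–Thomas space. Let $\boldsymbol\sigma=-\nabla u\in \boldsymbol H^4(\Omega)$, and let $\boldsymbol\sigma_I\in\boldsymbol\Sigma_h$ be its interpolation, that is, $\int_e(\boldsymbol\sigma-\boldsymbol\sigma_I)\cdot\boldsymbol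 n\,ds=0$ for each edge $e$ of each $K\in\mathcal T_h$. Write $(\cdot,\cdot)$ for the inner product of $\boldsymbol L^2(\Omega)$ and $\|\boldsymbol\tau\|_{1,h}=\big(\sum_{K\in\mathcal T_h}\|\boldsymbol\tau\|_{1,K}^2\big)^{1/2}$ for the elementwise $H^1$ norm. Then for every $\boldsymbol\tau_h=(\tau_{h1},\tau_{h2})^T\in\boldsymbol\Sigma_h$, $$(\boldsymbol\sigma-\boldsymbol\sigma_I,\boldsymbol\tau_h)=\frac1{12}\sum_{K_{i,j}\in\mathcal T_h}\Big(h_{x_i}^2\int_{K_{i,j}}u_{xxx}\,\tau_{h1}\,dx\,dy+h_{y_j}^2\int_{K_{i,j}}u_{yyy}\,\tau_{h2}\,dx\,dy\Big)+O(h^4),$$ where the remainder is bounded in absolute value by $C\,h^4\,\|\boldsymbol\sigma\|_{4,\Omega}\,\|\boldsymbol\tau_h\|_{1,h}$ with an absolute constant $C$, independent of $\Omega$, the mesh, $u$ and $\boldsymbol\tau_h$. -/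

import Mathlib

open MeasureTheory Set Filter Topology
open scoped ContDiff

noncomputable section

namespace RRT

/-! ### Sobolev spaces on open subsets of the plane, through weak derivatives -/

/-- The classical partial derivative in the first variable. -/
def dx (φ : ℝ × ℝ → ℝ) : ℝ × ℝ → ℝ := fun p => fderiv ℝ φ p (1, 0)

/-- The classical partial derivative in the second variable. -/
def dy (φ : ℝ × ℝ → ℝ) : ℝ × ℝ → ℝ := fun p => fderiv ℝ φ p (0, 1)

/-- Test functions: smooth functions with compact support contained in `Ω`. -/
structure IsTestFunction (Ω : Set (ℝ × ℝ)) (φ : ℝ × ℝ → ℝ) : Prop where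
  smooth : ContDiff ℝ ∞ φ
  compact : HasCompactSupport φ
  support_subset : tsupport φ ⊆ Ω

/-- `g` is the weak derivative `∂ₓᵃ ∂ᵧᵇ f` on `Ω`. -/
structure IsWeakDeriv (Ω : Set (ℝ × ℝ)) (a b : ℕ) (f g : ℝ × ℝ → ℝ) : Prop where
  locInt_left : LocallyIntegrableOn f Ω
  locInt_right : LocallyIntegrableOn g Ω
  integral_eq : ∀ φ : ℝ × ℝ → ℝ, IsTestFunction Ω φ →
    ∫ p in Ω, f p * (dx^[a] (dy^[b] φ)) p = (-1) ^ (a + b) * ∫ p in Ω, g p * φ p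

open Classical in
/-- The weak derivative `∂ₓᵃ ∂ᵧᵇ f` on `Ω` (a representative of it; zero if there is none). -/
def weakDeriv (Ω : Set (ℝ × ℝ)) (a b : ℕ) (f : ℝ × ℝ → ℝ) : ℝ × ℝ → ℝ :=
  if h : ∃ g, IsWeakDeriv Ω a b f g then h.choose else 0

/-- `f ∈ Hᵏ(Ω)`: all weak derivatives of order at most `k` exist and lie in `L²(Ω)`. -/
def MemH (Ω : Set (ℝ × ℝ)) (k : ℕ) (f : ℝ × ℝ → ℝ) : Prop :=
  ∀ a b : ℕ, a + b ≤ k → ∃ g, IsWeakDeriv Ω a b f g ∧ MemLp g 2 (volume.restrict Ω)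

/-- The square of the norm of `Hᵏ(Ω)`. -/
def normHSq (Ω : Set (ℝ × ℝ)) (k : ℕ) (f : ℝ × ℝ → ℝ) : ℝ :=
  ∑ m ∈ Finset.range (k + 1), ∑ α ∈ Finset.HasAntidiagonal.antidiagonal m,
    ∫ p in Ω, (weakDeriv Ω α.1 α.2 f p) ^ 2

/-- A vector field has both components in `Hᵏ(Ω)`. -/
def VecMemH (Ω : Set (ℝ × ℝ)) (k : ℕ) (w : ℝ × ℝ → ℝ × ℝ) : Prop :=
  MemH Ω k (fun p => (w p).1) ∧ MemH Ω k (fun p => (w p).2)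

/-- The square of the norm of a vector field in `Hᵏ(Ω)²`. -/
def vecNormHSq (Ω : Set (ℝ × ℝ)) (k : ℕ) (w : ℝ × ℝ → ℝ × ℝ) : ℝ :=
  normHSq Ω k (fun p => (w p).1) + normHSq Ω k (fun p => (w p).2)

/-- The norm of a vector field in `Hᵏ(Ω)²`. -/
def vecNormH (Ω : Set (ℝ × ℝ)) (k : ℕ) (w : ℝ × ℝ → ℝ × ℝ) : ℝ :=
  Real.sqrt (vecNormHSq Ω k w)

/-- `g = ∇f` weakly on `Ω`. -/
def IsWeakGrad (Ω : Set (ℝ × ℝ)) (f : ℝ × ℝ → ℝ) (g : ℝ × ℝ → ℝ × ℝ) : Prop :=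
  IsWeakDeriv Ω 1 0 f (fun p => (g p).1) ∧ IsWeakDeriv Ω 0 1 f (fun p => (g p).2)

/-- The Euclidean dot product of the plane. -/
def dot (v w : ℝ × ℝ) : ℝ := v.1 * w.1 + v.2 * w.2

/-- The inner product `(v, w)_Ω` of `L²(Ω)²`. -/
def innerL2 (Ω : Set (ℝ × ℝ)) (v w : ℝ × ℝ → ℝ × ℝ) : ℝ := ∫ p in Ω, dot (v p) (w p)

/-- `τ ∈ H(div, Ω)`: `τ` is square integrable and so is its weak divergence. -/
def MemHdiv (Ω : Set (ℝ × ℝ)) (τ : ℝ × ℝ → ℝ × ℝ) : Prop :=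
  MemLp (fun p => (τ p).1) 2 (volume.restrict Ω) ∧
  MemLp (fun p => (τ p).2) 2 (volume.restrict Ω) ∧
  ∃ d : ℝ × ℝ → ℝ, MemLp d 2 (volume.restrict Ω) ∧
    ∀ φ : ℝ × ℝ → ℝ, IsTestFunction Ω φ →
      ∫ p in Ω, dot (τ p) (dx φ p, dy φ p) = -∫ p in Ω, d p * φ p

/-! ### Rectangular meshes -/

/-- The node vectors `x₀ < ⋯ < x_{n₁}` and `y₀ < ⋯ < y_{n₂}` of a rectangular grid. The pair
`(i, j) : Fin n₁ × Fin n₂` labels the rectangle between the nodes `i`, `i + 1` and `j`, `j + 1`. -/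
structure Grid where
  n₁ : ℕ
  n₂ : ℕ
  x : Fin (n₁ + 1) → ℝ
  y : Fin (n₂ + 1) → ℝ
  x_strictMono : StrictMono x
  y_strictMono : StrictMono y

namespace Grid

variable (G : Grid)

/-- The width of the `i`-th column. -/
def hx (i : Fin G.n₁) : ℝ := G.x i.succ - G.x i.castSucc

/-- The height of the `j`-th row. -/
def hy (j : Fin G.n₂) : ℝ := G.y j.succ - G.y j.castSucc

/-- The closed rectangle `K_{i,j}`. -/
def cell (K : Fin G.n₁ × Fin G.n₂) : Set (ℝ × ℝ) :=
  Icc (G.x K.1.castSucc) (G.x K.1.succ) ×ˢ Icc (G.y K.2.castSucc) (G.y K.2.succ)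

/-- The open rectangle, the interior of `K_{i,j}`. -/
def openCell (K : Fin G.n₁ × Fin G.n₂) : Set (ℝ × ℝ) :=
  Ioo (G.x K.1.castSucc) (G.x K.1.succ) ×ˢ Ioo (G.y K.2.castSucc) (G.y K.2.succ)

open Classical in
/-- The mesh `𝒯_h = {K_{i,j} : K_{i,j} ⊆ closure Ω}`. -/
def mesh (Ω : Set (ℝ × ℝ)) : Finset (Fin G.n₁ × Fin G.n₂) :=
  Finset.univ.filter fun K => G.cell K ⊆ closure Ω

/-- The elements of the mesh divide `Ω`: they fill it up, and none of them is cut by its boundary. -/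
def Divides (Ω : Set (ℝ × ℝ)) : Prop :=
  (closure Ω = ⋃ K ∈ G.mesh Ω, G.cell K) ∧ ∀ K ∈ G.mesh Ω, G.openCell K ⊆ Ω

/-- The mesh size `h`, the greatest side length of an element. -/
def meshSize (Ω : Set (ℝ × ℝ)) : ℝ :=
  ⨆ K : {K // K ∈ G.mesh Ω}, max (G.hx K.1.1) (G.hy K.1.2)

/-- The lowest order rectangular Raviart-Thomas space `Σ_h`: the fields of `H(div, Ω)` that
belong to `Q₁₀(K) × Q₀₁(K)` on each element `K`. -/
def MemRT (Ω : Set (ℝ × ℝ)) (τ : ℝ × ℝ → ℝ × ℝ) : Prop :=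
  MemHdiv Ω τ ∧ ∀ K ∈ G.mesh Ω, ∃ a b c d : ℝ,
    ∀ᵐ p ∂(volume.restrict (G.cell K)), τ p = (a + b * p.1, c + d * p.2)

/-- The norm `(∑_K ‖τ‖²_{1,K})^{1/2}` of the elementwise `H¹` vector fields. -/
def brokenNormH1 (Ω : Set (ℝ × ℝ)) (τ : ℝ × ℝ → ℝ × ℝ) : ℝ :=
  Real.sqrt (∑ K ∈ G.mesh Ω, vecNormHSq (G.openCell K) 1 τ)

end Grid

/-- The four edges of a rectangle. -/
inductive Side
  | left
  | right
  | bottom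
  | top

/-- The outward unit normal of an edge. -/
def Side.normal : Side → ℝ × ℝ
  | .left => (-1, 0)
  | .right => (1, 0)
  | .bottom => (0, -1)
  | .top => (0, 1)

namespace Grid

variable (G : Grid)

/-- The part of width `ε` of the rectangle along one of its edges. -/
def strip (K : Fin G.n₁ × Fin G.n₂) (ε : ℝ) : Side → Set (ℝ × ℝ)
  | .left => G.openCell K ∩ {p | p.1 < G.x K.1.castSucc + ε}
  | .right => G.openCell K ∩ {p | G.x K.1.succ - ε < p.1}
  | .bottom => G.openCell K ∩ {p | p.2 < G.y K.2.castSucc + ε}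
  | .top => G.openCell K ∩ {p | G.y K.2.succ - ε < p.2}

/-- `∫_e w ⋅ n ds = F` for the edge `e` of the element `K`, where the values of `w` on `e` are
the trace from inside `K`: the edge integral of the trace is the limit of the integrals over thin
strips along the edge, divided by their width. -/
def HasEdgeFlux (K : Fin G.n₁ × Fin G.n₂) (e : Side) (w : ℝ × ℝ → ℝ × ℝ) (F : ℝ) : Prop :=
  Tendsto (fun ε : ℝ => ε⁻¹ * ∫ p in G.strip K ε e, dot (w p) e.normal) (𝓝[>] 0) (𝓝 F)

/-- `σI` is the interpolation of `σ`: it belongs to `Σ_h`, and `∫_e (σ - σI) ⋅ n ds = 0` for each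
edge `e` of each element. -/
def IsInterpolation (Ω : Set (ℝ × ℝ)) (σ σI : ℝ × ℝ → ℝ × ℝ) : Prop :=
  G.MemRT Ω σI ∧ ∀ K ∈ G.mesh Ω, ∀ e : Side, G.HasEdgeFlux K e (fun p => σ p - σI p) 0

end Grid

end RRT

end

/-!
The estimate is local: on each rectangle `K = (a, b) × (c, d)` of the mesh the error of one
component against a Raviart-Thomas field has an exact expression. Let `w` be the first component of
`σ - σ_I`, let `τ = α + β x` be that of the test field, and let `Q = ((x - a) (x - b))² / 24`. Then

  `∫_K w τ + (b - a)² / 12 ∫_K (∂ₓ² w) τ = ∫_K Q ((∂ₓ⁴ w) τ + 4 β ∂ₓ³ w)`.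

Since `∂ₓ² w = ∂ₓ² σ₁ = -u_xxx`, the left side is the error minus the claimed leading term, and as
`0 ≤ Q ≤ (b - a)⁴ / 384` on `K`, the right side is at most
`h⁴ (‖∂ₓ⁴ σ₁‖_K ‖τ‖_K + ‖∂ₓ³ σ₁‖_K ‖∂ₓ τ‖_K)`. The second component is treated by exchanging
the variables, and the Cauchy-Schwarz inequality for the sum over the mesh gives the theorem with
the constant `1`.

The identity is one-dimensional (`integral_mul_affine_eq`): the integrals of `w` over the vertical
sections of `K` form a function `f` on `(a, b)` with four integrable weak derivatives
(`IsWeakDeriv.isWeakDerivFst`), and `f` vanishes at both ends because the fluxes through the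
vertical edges do. Integrating by parts twice, `∫ f τ = ∫ f'' Z` where `Z'' = τ` and `Z` vanishes at
the ends, whereas `∫ Q (f'''' τ + 4 β f''') = ∫ f'' (Q'' τ - 2 β Q')` since `Q` vanishes to
second order there; and `Z + (b - a)² / 12 τ = Q'' τ - 2 β Q'`. Integration by parts with boundary
terms for functions that have only weak derivatives is `IsWeakDerivOn.exists_trace`: by the lemma of
du Bois-Reymond such a function is, up to a null set, a constant plus the primitive of its weak
derivative, and its end values are the limits of the averages over thin strips by which edge fluxes
are defined.
-/

noncomputable section

namespace RRT

/-! ### Weak derivatives on an interval -/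

/-- Test functions of one variable: smooth functions with compact support contained in `(a, b)`. -/
structure IsTest (a b : ℝ) (η : ℝ → ℝ) : Prop where
  smooth : ContDiff ℝ ∞ η
  compact : HasCompactSupport η
  support_subset : tsupport η ⊆ Ioo a b

namespace IsTest

variable {a b : ℝ} {η : ℝ → ℝ}

lemma deriv (h : IsTest a b η) : IsTest a b (deriv η) where
  smooth := (contDiff_infty_iff_deriv.1 h.smooth).2
  compact := h.compact.deriv
  support_subset := (closure_minimal support_deriv_subset (isClosed_tsupport η)).trans
    h.support_subset

lemma eq_zero_of_notMem (h : IsTest a b η) {x : ℝ} (hx : x ∉ Ioo a b) : η x = 0 :=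
  image_eq_zero_of_notMem_tsupport fun hx' => hx (h.support_subset hx')

lemma integral_mul_eq (hab : a ≤ b) (h : IsTest a b η) (f : ℝ → ℝ) :
    ∫ x, η x * f x = ∫ x in a..b, f x * η x := by
  rw [intervalIntegral.integral_of_le hab, setIntegral_eq_integral_of_forall_compl_eq_zero]
  · simp only [mul_comm]
  · intro x hx
    rw [h.eq_zero_of_notMem fun hx' => hx ⟨hx'.1, hx'.2.le⟩, mul_zero]

/-- A test function with integral zero is the derivative of a test function. -/
lemma exists_deriv_eq (h : IsTest a b η) (h0 : ∫ x in a..b, η x = 0) :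
    ∃ ψ, IsTest a b ψ ∧ _root_.deriv ψ = η := by
  rcases (tsupport η).eq_empty_or_nonempty with he | hne
  · refine ⟨η, h, ?_⟩
    have : η = 0 := tsupport_eq_empty_iff.1 he
    rw [this]
    ext x
    simp
  have hc : IsCompact (tsupport η) := h.compact
  have hl := h.support_subset (hc.sInf_mem hne)
  have hr := h.support_subset (hc.sSup_mem hne)
  set a' := sInf (tsupport η)
  set b' := sSup (tsupport η)
  have hz : ∀ x, x ∉ Icc a' b' → η x = 0 := fun x hx =>
    image_eq_zero_of_notMem_tsupport fun hx' =>
      hx ⟨csInf_le hc.bddBelow hx', le_csSup hc.bddAbove hx'⟩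
  have hcont := h.smooth.continuous
  have hd : ∀ x, HasDerivAt (fun x => ∫ t in a..x, η t) (η x) x := fun x =>
    hcont.integral_hasStrictDerivAt a x |>.hasDerivAt
  have hd' : _root_.deriv (fun x => ∫ t in a..x, η t) = η := funext fun x => (hd x).deriv
  have hsupp : tsupport (fun x => ∫ t in a..x, η t) ⊆ Icc a' b' := by
    refine closure_minimal (fun x hx => ?_) isClosed_Icc
    by_contra hx'
    refine hx ?_
    rcases not_and_or.1 hx' with h1 | h1
    · refine intervalIntegral.integral_zero_ae (.of_forall fun t ht => hz t fun ht' => ?_)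
      have : t ≤ max a x := ht.2
      rcases le_max_iff.1 this with h2 | h2 <;> linarith [ht'.1, hl.1]
    · have h2 : ∫ t in x..b, η t = 0 := by
        refine intervalIntegral.integral_zero_ae (.of_forall fun t ht => hz t fun ht' => ?_)
        have : min x b < t := ht.1
        rcases min_lt_iff.1 this with h2 | h2 <;> linarith [ht'.2, hr.2]
      have h3 := intervalIntegral.integral_add_adjacent_intervals
        (hcont.intervalIntegrable (μ := volume) a x) (hcont.intervalIntegrable x b)
      simp only
      linarith
  refine ⟨fun x => ∫ t in a..x, η t, ⟨?_, ?_, ?_⟩, hd'⟩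
  · rw [contDiff_infty_iff_deriv, hd']
    exact ⟨fun x => (hd x).differentiableAt, h.smooth⟩
  · exact isCompact_Icc.of_isClosed_subset (isClosed_tsupport _) hsupp
  · exact hsupp.trans fun x hx => ⟨hl.1.trans_le hx.1, hx.2.trans_lt hr.2⟩

lemma sub_const_mul (h : IsTest a b η) {ρ : ℝ → ℝ} (hρ : IsTest a b ρ) (c : ℝ) :
    IsTest a b (fun x => η x - c * ρ x) where
  smooth := h.smooth.sub (contDiff_const.mul hρ.smooth)
  compact := h.compact.sub (hρ.compact.mul_left (f := fun _ => c))
  support_subset := by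
    refine (tsupport_sub η (fun x => c * ρ x)).trans (union_subset h.support_subset ?_)
    exact (tsupport_mul_subset_right (f := fun _ => c) (g := ρ)).trans hρ.support_subset

/-- A normalized bump function. -/
lemma exists_integral_eq_one (hab : a < b) : ∃ ρ, IsTest a b ρ ∧ ∫ x in a..b, ρ x = 1 := by
  let B : ContDiffBump ((a + b) / 2) := ⟨(b - a) / 8, (b - a) / 4, by linarith, by linarith⟩
  have ht : IsTest a b (B.normed volume) := by
    refine ⟨B.contDiff_normed, B.hasCompactSupport_normed, ?_⟩
    rw [B.tsupport_normed_eq, Real.closedBall_eq_Icc]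
    intro x hx
    have h1 := hx.1
    have h2 := hx.2
    simp only [B] at h1 h2
    constructor <;> linarith
  refine ⟨B.normed volume, ht, ?_⟩
  have := ht.integral_mul_eq hab.le (fun _ => 1)
  simp only [one_mul, mul_one] at this
  rw [← this, B.integral_normed]

end IsTest

/-- The lemma of du Bois-Reymond: a function whose weak derivative vanishes is constant. -/
lemma exists_ae_eq_const_of_integral_mul_deriv_eq_zero {a b : ℝ} (hab : a < b) {f : ℝ → ℝ}
    (hf : IntervalIntegrable f volume a b)
    (h : ∀ η, IsTest a b η → ∫ x in a..b, f x * deriv η x = 0) :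
    ∃ c, ∀ᵐ x, x ∈ Ioo a b → f x = c := by
  obtain ⟨ρ, hρ, hρ1⟩ := IsTest.exists_integral_eq_one hab
  refine ⟨∫ x in a..b, f x * ρ x, ?_⟩
  set c := ∫ x in a..b, f x * ρ x with hc
  have hloc : LocallyIntegrableOn (fun x => f x - c) (Ioo a b) := by
    refine IntegrableOn.locallyIntegrableOn ?_
    have : IntegrableOn (fun x => f x - c) (Ioc a b) :=
      (intervalIntegrable_iff_integrableOn_Ioc_of_le hab.le).1 (hf.sub intervalIntegrable_const)
    exact this.mono_set Ioo_subset_Ioc_self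
  have := isOpen_Ioo.ae_eq_zero_of_integral_contDiff_smul_eq_zero hloc ?_
  · filter_upwards [this] with x hx hx'
    linarith [hx hx']
  intro η h1 h2 h3
  have hη : IsTest a b η := ⟨h1, h2, h3⟩
  simp only [smul_eq_mul]
  rw [hη.integral_mul_eq hab.le]
  have iη : IntervalIntegrable η volume a b := h1.continuous.intervalIntegrable a b
  have iρ : IntervalIntegrable ρ volume a b := hρ.smooth.continuous.intervalIntegrable a b
  have ifη : IntervalIntegrable (fun x => f x * η x) volume a b :=
    hf.mul_continuousOn h1.continuous.continuousOn
  have ifρ : IntervalIntegrable (fun x => f x * ρ x) volume a b :=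
    hf.mul_continuousOn hρ.smooth.continuous.continuousOn
  -- Subtracting a multiple of `ρ` makes the integral of `η` vanish, so that the difference is
  -- the derivative of a test function.
  obtain ⟨ψ, hψ, hψ'⟩ := (hη.sub_const_mul hρ (∫ x in a..b, η x)).exists_deriv_eq (by
    rw [intervalIntegral.integral_sub iη (iρ.const_mul _), intervalIntegral.integral_const_mul,
      hρ1]
    ring)
  have key := h ψ hψ
  rw [hψ'] at key
  have e1 : ∀ x, f x * (η x - (∫ x in a..b, η x) * ρ x)
      = f x * η x - (∫ x in a..b, η x) * (f x * ρ x) := fun x => by ring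
  simp only [e1] at key
  rw [intervalIntegral.integral_sub ifη (ifρ.const_mul _), intervalIntegral.integral_const_mul,
    ← hc] at key
  simp only [sub_mul]
  rw [intervalIntegral.integral_sub ifη (iη.const_mul _), intervalIntegral.integral_const_mul]
  linarith

/-- Integration by parts for the primitive of an integrable function against a `C¹` function. -/
lemma integral_primitive_mul_deriv {a b : ℝ} {f P : ℝ → ℝ}
    (hf : IntervalIntegrable f volume a b) (hP : ContDiff ℝ 1 P) :
    ∫ x in a..b, (∫ t in a..x, f t) * deriv P x
      = (∫ t in a..b, f t) * P b - ∫ x in a..b, f x * P x := by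
  have h1 := hf.absolutelyContinuousOnInterval_intervalIntegral (c := a) left_mem_uIcc
  have h2 : AbsolutelyContinuousOnInterval P a b :=
    hP.contDiffOn.absolutelyContinuousOnInterval
  rw [h1.integral_mul_deriv_eq_deriv_mul h2, intervalIntegral.integral_same, zero_mul, sub_zero]
  congr 1
  refine intervalIntegral.integral_congr_ae ?_
  filter_upwards [hf.ae_hasDerivAt_integral] with x hx hx'
  rw [(hx (uIoc_subset_uIcc hx') a left_mem_uIcc).deriv]

/-- `f'` is the weak derivative of `f` on `(a, b)`, and both functions are integrable up to the end
points. -/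
structure IsWeakDerivOn (a b : ℝ) (f f' : ℝ → ℝ) : Prop where
  left : IntervalIntegrable f volume a b
  right : IntervalIntegrable f' volume a b
  integral_eq : ∀ η, IsTest a b η →
    ∫ x in a..b, f x * deriv η x = -∫ x in a..b, f' x * η x

lemma eventually_pos_and_lt {ℓ : ℝ} (hℓ : 0 < ℓ) : ∀ᶠ ε : ℝ in 𝓝[>] 0, 0 < ε ∧ ε < ℓ := by
  filter_upwards [Ioo_mem_nhdsGT hℓ] with ε hε using hε

/-- An integrable function with an integrable weak derivative on `(a, b)` has traces `A` and `B` at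
the end points; they are the limits of its means, and they are the boundary values in the
integration by parts against functions that need not vanish at the end points. -/
lemma IsWeakDerivOn.exists_trace {a b : ℝ} (hab : a < b) {f f' : ℝ → ℝ}
    (h : IsWeakDerivOn a b f f') : ∃ A B : ℝ,
      (∀ P, ContDiff ℝ 1 P →
        ∫ x in a..b, f x * deriv P x = B * P b - A * P a - ∫ x in a..b, f' x * P x) ∧
      Tendsto (fun ε => ε⁻¹ * ∫ x in a..a + ε, f x) (𝓝[>] 0) (𝓝 A) ∧
      Tendsto (fun ε => ε⁻¹ * ∫ x in b - ε..b, f x) (𝓝[>] 0) (𝓝 B) := by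
  have hac : IntervalIntegrable (fun x => ∫ t in a..x, f' t) volume a b :=
    (h.right.absolutelyContinuousOnInterval_intervalIntegral
      (c := a) left_mem_uIcc).continuousOn.intervalIntegrable
  obtain ⟨c, hc⟩ := exists_ae_eq_const_of_integral_mul_deriv_eq_zero hab (h.left.sub hac) (by
    intro η hη
    have hd := hη.deriv.smooth.continuous.continuousOn (s := uIcc a b)
    simp only [sub_mul]
    rw [intervalIntegral.integral_sub (h.left.mul_continuousOn hd) (hac.mul_continuousOn hd),
      h.integral_eq η hη,
      integral_primitive_mul_deriv h.right (hη.smooth.of_le (by exact_mod_cast le_top)),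
      hη.eq_zero_of_notMem (x := b) (by simp)]
    ring)
  -- Cutting `f'` off outside of the interval makes the primitive continuous on the whole line.
  set k : ℝ → ℝ := (Ioc a b).indicator f'
  have hk : Integrable k :=
    ((intervalIntegrable_iff_integrableOn_Ioc_of_le hab.le).1 h.right).integrable_indicator
      measurableSet_Ioc
  have hG : Continuous fun x => c + ∫ t in a..x, k t :=
    continuous_const.add
      (intervalIntegral.continuous_primitive (fun _ _ => hk.intervalIntegrable) a)
  have hkf : ∀ x ∈ Icc a b, ∫ t in a..x, k t = ∫ t in a..x, f' t := by
    intro x hx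
    refine intervalIntegral.integral_congr_ae (.of_forall fun t ht => ?_)
    rw [uIoc_of_le hx.1] at ht
    exact indicator_of_mem (show t ∈ Ioc a b from ⟨ht.1, ht.2.trans hx.2⟩) _
  set G : ℝ → ℝ := fun x => c + ∫ t in a..x, k t
  have hfG : ∀ᵐ x, x ∈ Ioc a b → f x = G x := by
    filter_upwards [hc, Measure.ae_ne volume b] with x hx hxb hx'
    have := hx ⟨hx'.1, lt_of_le_of_ne hx'.2 hxb⟩
    simp only [G, hkf x ⟨hx'.1.le, hx'.2⟩] at this ⊢
    linarith
  have hint : ∀ p q, a ≤ p → p ≤ q → q ≤ b → ∫ x in p..q, f x = ∫ x in p..q, G x := by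
    intro p q hp hpq hq
    refine intervalIntegral.integral_congr_ae ?_
    filter_upwards [hfG] with x hx hx'
    rw [uIoc_of_le hpq] at hx'
    exact hx ⟨hp.trans_lt hx'.1, hx'.2.trans hq⟩
  have hd : ∀ x, HasDerivAt (fun x => ∫ t in a..x, G t) (G x) x := fun x =>
    (hG.integral_hasStrictDerivAt a x).hasDerivAt
  have hsmall := eventually_pos_and_lt (sub_pos.2 hab)
  refine ⟨G a, G b, fun P hP => ?_, ?_, ?_⟩
  · have e1 : ∫ x in a..b, f x * deriv P x
        = ∫ x in a..b, (c * deriv P x + (∫ t in a..x, f' t) * deriv P x) := by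
      refine intervalIntegral.integral_congr_ae ?_
      filter_upwards [hfG] with x hx hx'
      rw [uIoc_of_le hab.le] at hx'
      rw [hx hx', ← hkf x ⟨hx'.1.le, hx'.2⟩]
      simp only [G]
      ring
    have hdP : Continuous (deriv P) := hP.continuous_deriv le_rfl
    rw [e1, intervalIntegral.integral_add ((hdP.intervalIntegrable a b).const_mul c)
      (hac.mul_continuousOn hdP.continuousOn), intervalIntegral.integral_const_mul,
      intervalIntegral.integral_deriv_eq_sub
        (fun x _ => (hP.differentiable one_ne_zero).differentiableAt)
        (hdP.intervalIntegrable a b), integral_primitive_mul_deriv h.right hP]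
    simp only [G, hkf b ⟨hab.le, le_rfl⟩, intervalIntegral.integral_same]
    ring
  · refine ((hd a).tendsto_slope_zero_right).congr' ?_
    filter_upwards [hsmall] with ε hε
    rw [smul_eq_mul, intervalIntegral.integral_same, sub_zero,
      hint a (a + ε) le_rfl (by linarith) (by linarith)]
  · have hneg : Tendsto (fun ε : ℝ => -ε) (𝓝[>] 0) (𝓝[<] 0) := by
      simpa using tendsto_neg_nhdsGT (a := (0 : ℝ))
    refine (((hd b).tendsto_slope_zero_left).comp hneg).congr' ?_
    filter_upwards [hsmall] with ε hε
    have h3 := intervalIntegral.integral_add_adjacent_intervals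
        (hG.intervalIntegrable (μ := volume) a (b - ε)) (hG.intervalIntegrable (b - ε) b)
    rw [hint (b - ε) b (by linarith) (by linarith) le_rfl]
    simp only [Function.comp, smul_eq_mul, ← sub_eq_add_neg, ← h3]
    rw [inv_neg]
    ring

/-! ### The error identity on an interval -/

/-- Integration by parts when the boundary terms vanish. -/
lemma IsWeakDerivOn.integral_mul_eq_neg {a b : ℝ} (hab : a < b) {f f' P P' : ℝ → ℝ}
    (h : IsWeakDerivOn a b f f') (hP : ∀ x, HasDerivAt P (P' x) x) (hP' : Continuous P')
    (ha : P a = 0) (hb : P b = 0) :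
    ∫ x in a..b, f x * P' x = -∫ x in a..b, f' x * P x := by
  obtain ⟨A, B, h1, -⟩ := h.exists_trace hab
  have hd : deriv P = P' := funext fun x => (hP x).deriv
  have := h1 P (contDiff_one_iff_deriv.2 ⟨fun x => (hP x).differentiableAt, hd ▸ hP'⟩)
  rw [hd, ha, hb] at this
  linarith

/-- Integration by parts for a function with vanishing traces. -/
lemma IsWeakDerivOn.integral_mul_eq_neg_of_trace {a b : ℝ} (hab : a < b) {f f' P P' : ℝ → ℝ}
    (h : IsWeakDerivOn a b f f') (hP : ∀ x, HasDerivAt P (P' x) x) (hP' : Continuous P')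
    (ha : Tendsto (fun ε => ε⁻¹ * ∫ x in a..a + ε, f x) (𝓝[>] 0) (𝓝 0))
    (hb : Tendsto (fun ε => ε⁻¹ * ∫ x in b - ε..b, f x) (𝓝[>] 0) (𝓝 0)) :
    ∫ x in a..b, f x * P' x = -∫ x in a..b, f' x * P x := by
  obtain ⟨A, B, h1, hA, hB⟩ := h.exists_trace hab
  have hd : deriv P = P' := funext fun x => (hP x).deriv
  have := h1 P (contDiff_one_iff_deriv.2 ⟨fun x => (hP x).differentiableAt, hd ▸ hP'⟩)
  rw [hd, tendsto_nhds_unique hA ha, tendsto_nhds_unique hB hb] at this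
  linarith

/-- The kernel `Q = ((x - a) (x - b))² / 24` of the superconvergence identity. It vanishes to second
order at both ends of the interval. -/
def kernel (a b x : ℝ) : ℝ := ((x - a) * (x - b)) ^ 2 / 24

/-- The error identity of the interpolation on an interval: if `f` has vanishing traces, then
`∫ f τ + (b - a)² / 12 ∫ f'' τ = ∫ Q (f'''' τ + 4 τ' f''')` for every affine function `τ`. -/
lemma integral_mul_affine_eq {a b : ℝ} (hab : a < b) {f₀ f₁ f₂ f₃ f₄ : ℝ → ℝ}
    (h₀ : IsWeakDerivOn a b f₀ f₁) (h₁ : IsWeakDerivOn a b f₁ f₂)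
    (h₂ : IsWeakDerivOn a b f₂ f₃) (h₃ : IsWeakDerivOn a b f₃ f₄)
    (ha : Tendsto (fun ε => ε⁻¹ * ∫ x in a..a + ε, f₀ x) (𝓝[>] 0) (𝓝 0))
    (hb : Tendsto (fun ε => ε⁻¹ * ∫ x in b - ε..b, f₀ x) (𝓝[>] 0) (𝓝 0)) (α β : ℝ) :
    (∫ x in a..b, f₀ x * (α + β * x)) + (b - a) ^ 2 / 12 * ∫ x in a..b, f₂ x * (α + β * x)
      = (∫ x in a..b, f₄ x * (kernel a b x * (α + β * x)))
        + ∫ x in a..b, f₃ x * (4 * β * kernel a b x) := by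
  -- With `q = (x - a) (x - b)`, so that `Q = q² / 24` and `q'² = 4 q + (b - a)²`, the function
  -- `Z = q (τ / 2 - τ' q' / 6)` has `Z'' = τ` and vanishes at the end points.
  set q : ℝ → ℝ := fun x => (x - a) * (x - b) with hq
  set q' : ℝ → ℝ := fun x => 2 * x - a - b with hq'
  set τ : ℝ → ℝ := fun x => α + β * x with hτ
  have dq : ∀ x, HasDerivAt q (q' x) x := fun x =>
    (((hasDerivAt_id x).sub_const a).fun_mul ((hasDerivAt_id x).sub_const b)).congr_deriv (by
      simp only [hq', id]; ring)
  have dq' : ∀ x, HasDerivAt q' 2 x := fun x =>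
    ((((hasDerivAt_id x).const_mul 2).sub_const a).sub_const b).congr_deriv (by ring)
  have dτ : ∀ x, HasDerivAt τ β x := fun x =>
    (((hasDerivAt_id x).const_mul β).const_add α).congr_deriv (by ring)
  have cq : Continuous q := by fun_prop
  have cq' : Continuous q' := by fun_prop
  have cτ : Continuous τ := by fun_prop
  have qa : q a = 0 := by simp [hq]
  have qb : q b = 0 := by simp [hq]
  set Z : ℝ → ℝ := fun x => q x * (τ x / 2 - β * q' x / 6) with hZ
  set Z' : ℝ → ℝ := fun x => q' x * (τ x / 2 - β * q' x / 6) + β * q x / 6 with hZ'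
  have dZ : ∀ x, HasDerivAt Z (Z' x) x := fun x =>
    ((dq x).fun_mul (((dτ x).div_const 2).fun_sub (((dq' x).const_mul β).div_const 6))).congr_deriv (by
      simp only [hZ']; ring)
  have dZ' : ∀ x, HasDerivAt Z' (τ x) x := fun x =>
    (((dq' x).fun_mul (((dτ x).div_const 2).fun_sub (((dq' x).const_mul β).div_const 6))).fun_add
      (((dq x).const_mul β).div_const 6)).congr_deriv (by ring)
  have cZ' : Continuous Z' := by fun_prop
  have e0 : ∫ x in a..b, f₀ x * τ x = ∫ x in a..b, f₂ x * Z x := by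
    rw [h₀.integral_mul_eq_neg_of_trace hab dZ' cτ ha hb,
      h₁.integral_mul_eq_neg hab dZ cZ' (by simp [hZ, qa]) (by simp [hZ, qb]), neg_neg]
  -- `N = Q τ` vanishes at the end points together with `M = 4 τ' Q - N'`, and
  -- `M' = -(Z + (b - a)² / 12 τ)`; this takes `f''''` and `f'''` back to `f''`.
  set N : ℝ → ℝ := fun x => q x ^ 2 / 24 * τ x with hN
  set N' : ℝ → ℝ := fun x => q x * q' x / 12 * τ x + q x ^ 2 / 24 * β with hN'
  have dN : ∀ x, HasDerivAt N (N' x) x := fun x =>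
    ((((dq x).fun_pow 2).div_const 24).fun_mul (dτ x)).congr_deriv (by
      simp only [hN', Nat.cast_ofNat, Nat.add_one_sub_one, pow_one]; ring)
  have cN' : Continuous N' := by fun_prop
  have e4 : ∫ x in a..b, f₄ x * N x = -∫ x in a..b, f₃ x * N' x := by
    rw [h₃.integral_mul_eq_neg hab dN cN' (by simp [hN, qa]) (by simp [hN, qb]), neg_neg]
  set M : ℝ → ℝ := fun x => q x ^ 2 / 6 * β - N' x with hM
  have dM : ∀ x, HasDerivAt M (-(Z x + (b - a) ^ 2 / 12 * τ x)) x := fun x => by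
    refine (((((dq x).fun_pow 2).div_const 6).mul_const β).fun_sub
      (((((dq x).fun_mul (dq' x)).div_const 12).fun_mul (dτ x)).fun_add
        ((((dq x).fun_pow 2).div_const 24).mul_const β))).congr_deriv ?_
    simp only [hZ, hq, hq', Nat.cast_ofNat, Nat.add_one_sub_one, pow_one]
    ring
  have cM : Continuous M := by fun_prop
  have cZ : Continuous Z := by fun_prop
  have e3 := h₂.integral_mul_eq_neg hab dM (by fun_prop) (by simp [hM, hN', qa])
    (by simp [hM, hN', qb])
  have i4 : (∫ x in a..b, f₃ x * M x)
      = (∫ x in a..b, f₃ x * (4 * β * kernel a b x)) - ∫ x in a..b, f₃ x * N' x := by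
    rw [← intervalIntegral.integral_sub (h₃.left.mul_continuousOn (by unfold kernel; fun_prop))
      (h₃.left.mul_continuousOn cN'.continuousOn)]
    congr 1
    ext x
    simp only [hM, hq, kernel]
    ring
  have i2 : (∫ x in a..b, f₂ x * -(Z x + (b - a) ^ 2 / 12 * τ x))
      = -((∫ x in a..b, f₂ x * Z x) + (b - a) ^ 2 / 12 * ∫ x in a..b, f₂ x * τ x) := by
    rw [← intervalIntegral.integral_const_mul, ← intervalIntegral.integral_add
      (h₂.left.mul_continuousOn cZ.continuousOn)
      ((h₂.left.mul_continuousOn cτ.continuousOn).const_mul _), ← intervalIntegral.integral_neg]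
    congr 1
    ext x
    ring
  have e4' : ∫ x in a..b, f₄ x * (kernel a b x * (α + β * x)) = -∫ x in a..b, f₃ x * N' x := e4
  rw [e4', e0]
  linarith

/-! ### From a rectangle to an interval -/

/-- `g` is the weak derivative of `f` in the first variable on the open rectangle
`(a, b) × (c, d)`, tested with functions of the first variable alone. -/
structure IsWeakDerivFst (a b c d : ℝ) (f g : ℝ × ℝ → ℝ) : Prop where
  left : IntegrableOn f (Ioo a b ×ˢ Ioo c d)
  right : IntegrableOn g (Ioo a b ×ˢ Ioo c d)
  integral_eq : ∀ η, IsTest a b η →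
    ∫ p in Ioo a b ×ˢ Ioo c d, f p * deriv η p.1 = -∫ p in Ioo a b ×ˢ Ioo c d, g p * η p.1

lemma integrableOn_mul_fst {a b c d : ℝ} {f : ℝ × ℝ → ℝ}
    (hf : IntegrableOn f (Ioo a b ×ˢ Ioo c d)) {ψ : ℝ → ℝ} (hψ : Continuous ψ) :
    IntegrableOn (fun p => f p * ψ p.1) (Ioo a b ×ˢ Ioo c d) := by
  obtain ⟨C, hC⟩ := isCompact_Icc.exists_bound_of_continuousOn (hψ.continuousOn (s := Icc a b))
  refine Integrable.mul_bdd (c := C) hf (hψ.comp continuous_fst).aestronglyMeasurable ?_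
  filter_upwards [ae_restrict_mem (measurableSet_Ioo.prod measurableSet_Ioo)] with p hp
  exact hC _ (Ioo_subset_Icc_self hp.1)

lemma setIntegral_prod_eq {a b c d : ℝ} (hab : a ≤ b) {f : ℝ × ℝ → ℝ}
    (hf : IntegrableOn f (Ioo a b ×ˢ Ioo c d)) :
    ∫ p in Ioo a b ×ˢ Ioo c d, f p = ∫ x in a..b, ∫ y in Ioo c d, f (x, y) := by
  rw [intervalIntegral.integral_of_le hab, integral_Ioc_eq_integral_Ioo]
  exact setIntegral_prod f hf

lemma setIntegral_prod_mul_fst {a b c d : ℝ} (hab : a ≤ b) {f : ℝ × ℝ → ℝ}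
    (hf : IntegrableOn f (Ioo a b ×ˢ Ioo c d)) {ψ : ℝ → ℝ} (hψ : Continuous ψ) :
    ∫ p in Ioo a b ×ˢ Ioo c d, f p * ψ p.1
      = ∫ x in a..b, (∫ y in Ioo c d, f (x, y)) * ψ x := by
  rw [setIntegral_prod_eq hab (integrableOn_mul_fst hf hψ)]
  simp only [integral_mul_const]

lemma IsWeakDerivFst.isWeakDerivOn {a b c d : ℝ} (hab : a ≤ b) {f g : ℝ × ℝ → ℝ}
    (h : IsWeakDerivFst a b c d f g) :
    IsWeakDerivOn a b (fun x => ∫ y in Ioo c d, f (x, y)) (fun x => ∫ y in Ioo c d, g (x, y)) := by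
  have key : ∀ k : ℝ × ℝ → ℝ, IntegrableOn k (Ioo a b ×ˢ Ioo c d) →
      IntervalIntegrable (fun x => ∫ y in Ioo c d, k (x, y)) volume a b := by
    intro k hk
    rw [intervalIntegrable_iff_integrableOn_Ioo_of_le hab]
    unfold IntegrableOn at hk
    rw [Measure.volume_eq_prod, ← Measure.prod_restrict] at hk
    exact hk.integral_prod_left
  refine ⟨key f h.left, key g h.right, fun η hη => ?_⟩
  rw [← setIntegral_prod_mul_fst hab h.left hη.deriv.smooth.continuous,
    ← setIntegral_prod_mul_fst hab h.right hη.smooth.continuous, h.integral_eq η hη]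

lemma IsWeakDerivFst.sub {a b c d : ℝ} {f g f' g' : ℝ × ℝ → ℝ}
    (h : IsWeakDerivFst a b c d f g) (h' : IsWeakDerivFst a b c d f' g') :
    IsWeakDerivFst a b c d (fun p => f p - f' p) (fun p => g p - g' p) := by
  refine ⟨h.left.sub h'.left, h.right.sub h'.right, fun η hη => ?_⟩
  have c1 := hη.deriv.smooth.continuous
  have c2 := hη.smooth.continuous
  simp only [sub_mul]
  rw [integral_sub (integrableOn_mul_fst h.left c1) (integrableOn_mul_fst h'.left c1),
    integral_sub (integrableOn_mul_fst h.right c2) (integrableOn_mul_fst h'.right c2),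
    h.integral_eq η hη, h'.integral_eq η hη]
  ring

/-- Smooth cut-off functions of an open interval. -/
lemma exists_cutoff {c d : ℝ} (hcd : c < d) : ∃ χ : ℕ → ℝ → ℝ,
    (∀ n, IsTest c d (χ n)) ∧ (∀ n y, ‖χ n y‖ ≤ 1) ∧
    ∀ y ∈ Ioo c d, Tendsto (fun n => χ n y) atTop (𝓝 1) := by
  have hr : 0 < (d - c) / 2 := by linarith
  set r := (d - c) / 2 with hrd
  have hn : ∀ n : ℕ, (0 : ℝ) < (n : ℝ) + 2 := fun n => by positivity
  have h1 : ∀ n : ℕ, 0 < r - r / ((n : ℝ) + 2) := fun n => by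
    have : r / ((n : ℝ) + 2) < r := div_lt_self hr (by linarith [n.cast_nonneg (α := ℝ)])
    linarith
  have h2 : ∀ n : ℕ, r - r / ((n : ℝ) + 2) < r - r / (2 * ((n : ℝ) + 2)) := fun n => by
    have : r / (2 * ((n : ℝ) + 2)) < r / ((n : ℝ) + 2) :=
      div_lt_div_of_pos_left hr (hn n) (by linarith [hn n])
    linarith
  let B : ℕ → ContDiffBump ((c + d) / 2) := fun n =>
    ⟨r - r / ((n : ℝ) + 2), r - r / (2 * ((n : ℝ) + 2)), h1 n, h2 n⟩
  refine ⟨fun n => B n, fun n => ⟨(B n).contDiff, (B n).hasCompactSupport, ?_⟩, fun n y => ?_,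
    fun y hy => ?_⟩
  · rw [(B n).tsupport_eq, Real.closedBall_eq_Icc]
    have h3 : 0 < r / (2 * ((n : ℝ) + 2)) := div_pos hr (by linarith [hn n])
    intro x hx
    have h4 := hx.1
    have h5 := hx.2
    simp only [B] at h4 h5
    constructor <;> linarith
  · rw [Real.norm_of_nonneg (B n).nonneg]
    exact (B n).le_one
  · have hy' : |y - (c + d) / 2| < r := by
      rw [abs_lt]
      constructor <;> linarith [hy.1, hy.2]
    have hlim : Tendsto (fun n : ℕ => r - r / ((n : ℝ) + 2)) atTop (𝓝 (r - 0)) :=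
      tendsto_const_nhds.sub (tendsto_const_nhds.div_atTop
        (tendsto_atTop_add_const_right _ _ tendsto_natCast_atTop_atTop))
    rw [sub_zero] at hlim
    refine tendsto_const_nhds.congr' ?_
    filter_upwards [hlim.eventually (lt_mem_nhds hy')] with n hn'
    refine ((B n).one_of_mem_closedBall ?_).symm
    rw [Metric.mem_closedBall, Real.dist_eq]
    exact hn'.le

lemma dx_mul_eq {η χ : ℝ → ℝ} (hη : Differentiable ℝ η) (hχ : Differentiable ℝ χ) :
    dx (fun p => η p.1 * χ p.2) = fun p => deriv η p.1 * χ p.2 := by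
  ext p
  have h1 : HasFDerivAt (fun p : ℝ × ℝ => η p.1) (deriv η p.1 • ContinuousLinearMap.fst ℝ ℝ ℝ) p :=
    (hη p.1).hasDerivAt.comp_hasFDerivAt p hasFDerivAt_fst
  have h2 : HasFDerivAt (fun p : ℝ × ℝ => χ p.2) (deriv χ p.2 • ContinuousLinearMap.snd ℝ ℝ ℝ) p :=
    (hχ p.2).hasDerivAt.comp_hasFDerivAt p hasFDerivAt_snd
  have h := (h1.fun_mul h2).fderiv
  simp only [dx, h]
  simp [mul_comm]

lemma IsTest.isTestFunction_mul {a b c d : ℝ} {η χ : ℝ → ℝ} (hη : IsTest a b η)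
    (hχ : IsTest c d χ) : IsTestFunction (Ioo a b ×ˢ Ioo c d) (fun p => η p.1 * χ p.2) := by
  have hs : tsupport (fun p : ℝ × ℝ => η p.1 * χ p.2) ⊆ tsupport η ×ˢ tsupport χ := by
    refine closure_minimal (fun p hp => ?_) ((isClosed_tsupport η).prod (isClosed_tsupport χ))
    exact ⟨subset_tsupport _ (left_ne_zero_of_mul hp), subset_tsupport _ (right_ne_zero_of_mul hp)⟩
  exact ⟨(hη.smooth.comp contDiff_fst).mul (hχ.smooth.comp contDiff_snd),
    (hη.compact.isCompact.prod hχ.compact.isCompact).of_isClosed_subset (isClosed_tsupport _) hs,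
    hs.trans (prod_mono hη.support_subset hχ.support_subset)⟩

lemma IsTestFunction.mono {U V : Set (ℝ × ℝ)} (hUV : U ⊆ V) {φ : ℝ × ℝ → ℝ}
    (h : IsTestFunction U φ) : IsTestFunction V φ :=
  ⟨h.smooth, h.compact, h.support_subset.trans hUV⟩

/-- Weak derivatives in the first variable may be tested with functions of the first variable
alone, as they are limits of products with cut-off functions of the second one. -/
lemma IsWeakDeriv.isWeakDerivFst {Ω : Set (ℝ × ℝ)} {a b c d : ℝ} (hcd : c < d)
    (hΩ : Ioo a b ×ˢ Ioo c d ⊆ Ω) {k : ℕ} {w f g : ℝ × ℝ → ℝ}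
    (hf : IsWeakDeriv Ω k 0 w f) (hg : IsWeakDeriv Ω (k + 1) 0 w g)
    (hfi : IntegrableOn f (Ioo a b ×ˢ Ioo c d)) (hgi : IntegrableOn g (Ioo a b ×ˢ Ioo c d)) :
    IsWeakDerivFst a b c d f g := by
  refine ⟨hfi, hgi, fun η hη => ?_⟩
  obtain ⟨χ, hχ, hχ1, hχlim⟩ := exists_cutoff hcd
  have hmeas : MeasurableSet (Ioo a b ×ˢ Ioo c d) := measurableSet_Ioo.prod measurableSet_Ioo
  have hred : ∀ (k : ℝ × ℝ → ℝ) (ψ : ℝ → ℝ), IsTest a b ψ → ∀ n,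
      ∫ p in Ω, k p * (ψ p.1 * χ n p.2)
        = ∫ p in Ioo a b ×ˢ Ioo c d, k p * ψ p.1 * χ n p.2 := by
    intro k ψ hψ n
    simp only [mul_assoc]
    have hz : ∀ p, p ∉ Ioo a b ×ˢ Ioo c d → k p * (ψ p.1 * χ n p.2) = 0 := by
      intro p hp
      rcases not_and_or.1 hp with h | h
      · rw [hψ.eq_zero_of_notMem h, zero_mul, mul_zero]
      · rw [(hχ n).eq_zero_of_notMem h, mul_zero, mul_zero]
    rw [setIntegral_eq_integral_of_forall_compl_eq_zero hz,
      setIntegral_eq_integral_of_forall_compl_eq_zero fun p hp => hz p fun hp' => hp (hΩ hp')]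
  have hdct : ∀ (k : ℝ × ℝ → ℝ) (ψ : ℝ → ℝ), IntegrableOn k (Ioo a b ×ˢ Ioo c d) → IsTest a b ψ →
      Tendsto (fun n => ∫ p in Ω, k p * (ψ p.1 * χ n p.2)) atTop
        (𝓝 (∫ p in Ioo a b ×ˢ Ioo c d, k p * ψ p.1)) := by
    intro k ψ hk hψ
    simp only [hred k ψ hψ]
    have hi := integrableOn_mul_fst hk hψ.smooth.continuous
    refine tendsto_integral_of_dominated_convergence (fun p => ‖k p * ψ p.1‖) (fun n => ?_)
      hi.norm (fun n => .of_forall fun p => ?_) ?_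
    · exact hi.aestronglyMeasurable.mul
        ((hχ n).smooth.continuous.comp continuous_snd).aestronglyMeasurable
    · rw [norm_mul]
      exact mul_le_of_le_one_right (norm_nonneg _) (hχ1 n _)
    · filter_upwards [ae_restrict_mem hmeas] with p hp
      simpa using (hχlim p.2 hp.2).const_mul (k p * ψ p.1)
  refine tendsto_nhds_unique (hdct f _ hfi hη.deriv) ((hdct g _ hgi hη).neg.congr fun n => ?_)
  have hχd : Differentiable ℝ (χ n) := (hχ n).smooth.differentiable (by simp)
  -- Both sides are the integral of `w` against `∂ₓᵏ⁺¹ (η χₙ) = ∂ₓᵏ (η' χₙ)`.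
  have e1 := hf.integral_eq _ ((hη.deriv.isTestFunction_mul (hχ n)).mono hΩ)
  have e2 := hg.integral_eq _ ((hη.isTestFunction_mul (hχ n)).mono hΩ)
  simp only [Function.iterate_zero, id, add_zero] at e1 e2
  rw [Function.iterate_succ_apply, dx_mul_eq (hη.smooth.differentiable (by simp)) hχd, e1,
    pow_succ, mul_assoc] at e2
  have := mul_left_cancel₀ (pow_ne_zero k (by norm_num : (-1 : ℝ) ≠ 0)) e2
  rw [this]
  ring

/-! ### The error identity on a rectangle -/

lemma isWeakDerivFst_affine {a b c d : ℝ} (hab : a ≤ b) (p q : ℝ) :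
    IsWeakDerivFst a b c d (fun z => p + q * z.1) (fun _ => q) := by
  have hb : ∀ {f : ℝ × ℝ → ℝ}, Continuous f → IntegrableOn f (Ioo a b ×ˢ Ioo c d) := fun hf =>
    (hf.continuousOn.integrableOn_compact (isCompact_Icc.prod isCompact_Icc)).mono_set
      (prod_mono Ioo_subset_Icc_self Ioo_subset_Icc_self)
  have h1 := hb (f := fun z => p + q * z.1) (by fun_prop)
  have h2 := hb (f := fun _ => q) (by fun_prop)
  refine ⟨h1, h2, fun η hη => ?_⟩
  rw [setIntegral_prod_mul_fst hab h1 hη.deriv.smooth.continuous,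
    setIntegral_prod_mul_fst hab h2 hη.smooth.continuous]
  simp only [setIntegral_const, smul_eq_mul, mul_assoc, intervalIntegral.integral_const_mul]
  have hd : ∀ x, HasDerivAt (fun x : ℝ => p + q * x) q x := fun x =>
    (((hasDerivAt_id x).const_mul q).const_add p).congr_deriv (by ring)
  have := intervalIntegral.integral_mul_deriv_eq_deriv_mul (a := a) (b := b)
    (fun x _ => hd x) (fun x _ => ((hη.smooth.differentiable (by simp)) x).hasDerivAt)
    intervalIntegrable_const (hη.deriv.smooth.continuous.intervalIntegrable a b)
  rw [this, hη.eq_zero_of_notMem (x := a) (by simp), hη.eq_zero_of_notMem (x := b) (by simp),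
    intervalIntegral.integral_const_mul]
  ring

/-- The error identity of the interpolation on a rectangle, for the first component. The functions
`s` and `τ` are first components of Raviart-Thomas fields, and `w - s` has zero flux through the
two vertical edges. -/
theorem setIntegral_mul_affine_eq {Ω : Set (ℝ × ℝ)} {a b c d : ℝ} (hab : a < b) (hcd : c < d)
    (hΩ : Ioo a b ×ˢ Ioo c d ⊆ Ω) {v s τ : ℝ × ℝ → ℝ} {w : ℕ → ℝ × ℝ → ℝ}
    (hw : ∀ k ≤ 4, IsWeakDeriv Ω k 0 v (w k))
    (hi : ∀ k ≤ 4, IntegrableOn (w k) (Ioo a b ×ˢ Ioo c d)) {p q α β : ℝ}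
    (hs : ∀ᵐ z ∂volume.restrict (Ioo a b ×ˢ Ioo c d), s z = p + q * z.1)
    (hτ : ∀ᵐ z ∂volume.restrict (Ioo a b ×ˢ Ioo c d), τ z = α + β * z.1)
    (ha : Tendsto (fun ε => ε⁻¹ * ∫ z in Ioo a (a + ε) ×ˢ Ioo c d, (w 0 z - s z)) (𝓝[>] 0) (𝓝 0))
    (hb : Tendsto (fun ε => ε⁻¹ * ∫ z in Ioo (b - ε) b ×ˢ Ioo c d, (w 0 z - s z))
      (𝓝[>] 0) (𝓝 0)) :
    (∫ z in Ioo a b ×ˢ Ioo c d, (w 0 z - s z) * τ z)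
        + (b - a) ^ 2 / 12 * ∫ z in Ioo a b ×ˢ Ioo c d, w 2 z * τ z
      = ∫ z in Ioo a b ×ˢ Ioo c d, kernel a b z.1 * (w 4 z * τ z + 4 * (w 3 z * β)) := by
  have hW : ∀ k < 4, IsWeakDerivFst a b c d (w k) (w (k + 1)) := fun k hk =>
    (hw k hk.le).isWeakDerivFst hcd hΩ (hw (k + 1) hk) (hi k hk.le) (hi (k + 1) hk)
  have h0 := (hW 0 (by norm_num)).sub (isWeakDerivFst_affine (c := c) (d := d) hab.le p q)
  have h1 : IsWeakDerivFst a b c d (fun z => w 1 z - q) (w 2) := by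
    simpa using (hW 1 (by norm_num)).sub (isWeakDerivFst_affine (c := c) (d := d) hab.le q 0)
  have h2 := hW 2 (by norm_num)
  have h3 := hW 3 (by norm_num)
  have cτ : Continuous fun x : ℝ => α + β * x := by fun_prop
  have ck : Continuous (kernel a b) := by unfold kernel; fun_prop
  have hsmall := eventually_pos_and_lt (sub_pos.2 hab)
  have hstrip : ∀ x y, a ≤ x → x ≤ y → y ≤ b →
      ∫ z in Ioo x y ×ˢ Ioo c d, (w 0 z - s z)
        = ∫ x in x..y, ∫ y in Ioo c d, (w 0 (x, y) - (p + q * x)) := by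
    intro x y hx hxy hy
    have hsub : Ioo x y ×ˢ Ioo c d ⊆ Ioo a b ×ˢ Ioo c d :=
      prod_mono (Ioo_subset_Ioo hx hy) subset_rfl
    rw [← setIntegral_prod_eq hxy (f := fun z => w 0 z - (p + q * z.1)) (h0.left.mono_set hsub)]
    refine integral_congr_ae ?_
    filter_upwards [ae_restrict_of_ae_restrict_of_subset hsub hs] with z hz
    rw [hz]
  have key := integral_mul_affine_eq hab (h0.isWeakDerivOn hab.le) (h1.isWeakDerivOn hab.le)
    (h2.isWeakDerivOn hab.le) (h3.isWeakDerivOn hab.le)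
    (ha.congr' (by
      filter_upwards [hsmall] with ε hε
      rw [hstrip a (a + ε) le_rfl (by linarith) (by linarith)]))
    (hb.congr' (by
      filter_upwards [hsmall] with ε hε
      rw [hstrip (b - ε) b (by linarith) (by linarith) le_rfl])) α β
  have ckτ : Continuous fun x => kernel a b x * (α + β * x) := ck.mul cτ
  have ckβ : Continuous fun x => 4 * β * kernel a b x := continuous_const.mul ck
  rw [← setIntegral_prod_mul_fst hab.le h0.left cτ, ← setIntegral_prod_mul_fst hab.le h2.left cτ,
    ← setIntegral_prod_mul_fst hab.le h3.right ckτ, ← setIntegral_prod_mul_fst hab.le h3.left ckβ,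
    ← integral_add (integrableOn_mul_fst h3.right ckτ) (integrableOn_mul_fst h3.left ckβ)] at key
  refine Eq.trans (congrArg₂ (fun x y => x + (b - a) ^ 2 / 12 * y) ?_ ?_) (key.trans ?_)
  · refine integral_congr_ae ?_
    filter_upwards [hs, hτ] with z hz hz'
    rw [hz, hz']
  · refine integral_congr_ae ?_
    filter_upwards [hτ] with z hz'
    rw [hz']
  · refine integral_congr_ae ?_
    filter_upwards [hτ] with z hz'
    rw [hz']
    ring

/-- The bound is the value of the kernel at the midpoint, its maximum. -/
lemma abs_kernel_le {a b x : ℝ} (hx : x ∈ Ioo a b) : |kernel a b x| ≤ (b - a) ^ 4 / 384 := by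
  have h1 : 0 ≤ (x - a) * (b - x) := mul_nonneg (by linarith [hx.1]) (by linarith [hx.2])
  have h2 : (x - a) * (b - x) ≤ (b - a) ^ 2 / 4 := by nlinarith [sq_nonneg (2 * x - a - b)]
  have h3 := pow_le_pow_left₀ h1 h2 2
  unfold kernel
  rw [abs_of_nonneg (by positivity)]
  nlinarith

/-- The Cauchy-Schwarz inequality for real functions in `L²`. -/
lemma integral_abs_mul_abs_le {X : Type*} [MeasurableSpace X] {μ : Measure X} {f g : X → ℝ}
    (hf : MemLp f 2 μ) (hg : MemLp g 2 μ) :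
    ∫ x, |f x| * |g x| ∂μ ≤ √(∫ x, f x ^ 2 ∂μ) * √(∫ x, g x ^ 2 ∂μ) := by
  have h : Real.HolderConjugate 2 2 := Real.HolderConjugate.two_two
  have := integral_mul_le_Lp_mul_Lq_of_nonneg (μ := μ) h (f := fun x => |f x|) (g := fun x => |g x|)
    (.of_forall fun _ => abs_nonneg _) (.of_forall fun _ => abs_nonneg _)
    (by simpa [Pi.abs_def] using hf.abs) (by simpa [Pi.abs_def] using hg.abs)
  simpa [Real.sqrt_eq_rpow] using this

/-- The superconvergence estimate on a rectangle, for the first component. -/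
theorem abs_setIntegral_mul_affine_le {Ω : Set (ℝ × ℝ)} {a b c d : ℝ} (hab : a < b) (hcd : c < d)
    (hΩ : Ioo a b ×ˢ Ioo c d ⊆ Ω) {v s τ : ℝ × ℝ → ℝ} {w : ℕ → ℝ × ℝ → ℝ}
    (hw : ∀ k ≤ 4, IsWeakDeriv Ω k 0 v (w k))
    (hL : ∀ k ≤ 4, MemLp (w k) 2 (volume.restrict (Ioo a b ×ˢ Ioo c d)))
    {p q α β : ℝ}
    (hs : ∀ᵐ z ∂volume.restrict (Ioo a b ×ˢ Ioo c d), s z = p + q * z.1)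
    (hτ : ∀ᵐ z ∂volume.restrict (Ioo a b ×ˢ Ioo c d), τ z = α + β * z.1)
    (hτL : MemLp τ 2 (volume.restrict (Ioo a b ×ˢ Ioo c d)))
    (ha : Tendsto (fun ε => ε⁻¹ * ∫ z in Ioo a (a + ε) ×ˢ Ioo c d, (w 0 z - s z)) (𝓝[>] 0) (𝓝 0))
    (hb : Tendsto (fun ε => ε⁻¹ * ∫ z in Ioo (b - ε) b ×ˢ Ioo c d, (w 0 z - s z))
      (𝓝[>] 0) (𝓝 0)) :
    |(∫ z in Ioo a b ×ˢ Ioo c d, (w 0 z - s z) * τ z)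
        + (b - a) ^ 2 / 12 * ∫ z in Ioo a b ×ˢ Ioo c d, w 2 z * τ z|
      ≤ (b - a) ^ 4 *
        (√(∫ z in Ioo a b ×ˢ Ioo c d, w 4 z ^ 2) * √(∫ z in Ioo a b ×ˢ Ioo c d, τ z ^ 2)
          + √(∫ z in Ioo a b ×ˢ Ioo c d, w 3 z ^ 2) * √(∫ _ in Ioo a b ×ˢ Ioo c d, β ^ 2)) := by
  have hfin : IsFiniteMeasure (volume.restrict (Ioo a b ×ˢ Ioo c d)) := by
    refine isFiniteMeasure_restrict.2 (ne_of_lt ?_)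
    exact ((Metric.isBounded_Ioo a b).prod (Metric.isBounded_Ioo c d)).measure_lt_top
  have hi : ∀ k ≤ 4, IntegrableOn (w k) (Ioo a b ×ˢ Ioo c d) := fun k hk =>
    (hL k hk).integrable one_le_two
  have hβ : MemLp (fun _ : ℝ × ℝ => β) 2 (volume.restrict (Ioo a b ×ˢ Ioo c d)) := memLp_const β
  have i4 : Integrable (fun z => |w 4 z| * |τ z|) (volume.restrict (Ioo a b ×ˢ Ioo c d)) :=
    (hL 4 le_rfl).abs.integrable_mul hτL.abs
  have i3 : Integrable (fun z => |w 3 z| * |β|) (volume.restrict (Ioo a b ×ˢ Ioo c d)) :=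
    (hL 3 (by norm_num)).abs.integrable_mul hβ.abs
  rw [setIntegral_mul_affine_eq hab hcd hΩ hw hi hs hτ ha hb, ← Real.norm_eq_abs]
  have hba : 0 < b - a := by linarith
  calc ‖∫ z in Ioo a b ×ˢ Ioo c d, kernel a b z.1 * (w 4 z * τ z + 4 * (w 3 z * β))‖
      ≤ ∫ z in Ioo a b ×ˢ Ioo c d, (b - a) ^ 4 * (|w 4 z| * |τ z| + |w 3 z| * |β|) := by
        refine norm_integral_le_of_norm_le ((i4.add i3).const_mul _) ?_
        filter_upwards [ae_restrict_mem (measurableSet_Ioo.prod measurableSet_Ioo)] with z hz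
        have h1 := abs_kernel_le hz.1
        have h2 : |w 4 z * τ z + 4 * (w 3 z * β)| ≤ 4 * (|w 4 z| * |τ z| + |w 3 z| * |β|) := by
          refine (abs_add_le _ _).trans ?_
          rw [abs_mul, abs_mul 4, abs_mul (w 3 z), abs_of_pos (by norm_num : (0 : ℝ) < 4)]
          nlinarith [mul_nonneg (abs_nonneg (w 4 z)) (abs_nonneg (τ z))]
        rw [Real.norm_eq_abs, abs_mul]
        refine (mul_le_mul h1 h2 (abs_nonneg _) (by positivity)).trans ?_
        have h3 : 0 ≤ (b - a) ^ 4 * (|w 4 z| * |τ z| + |w 3 z| * |β|) := by positivity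
        linarith
    _ ≤ _ := by
        rw [integral_const_mul, integral_add i4 i3]
        gcongr
        · exact integral_abs_mul_abs_le (hL 4 le_rfl) hτL
        · exact integral_abs_mul_abs_le (hL 3 (by norm_num)) hβ

/-! ### Uniqueness of weak derivatives -/

lemma IsWeakDeriv.ae_eq {Ω : Set (ℝ × ℝ)} (hΩ : IsOpen Ω) {a b : ℕ} {f g g' : ℝ × ℝ → ℝ}
    (h : IsWeakDeriv Ω a b f g) (h' : IsWeakDeriv Ω a b f g') :
    ∀ᵐ z ∂volume.restrict Ω, g z = g' z := by
  rw [ae_restrict_iff' hΩ.measurableSet]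
  have := hΩ.ae_eq_zero_of_integral_contDiff_smul_eq_zero (μ := volume)
    (h.locInt_right.sub h'.locInt_right) ?_
  · filter_upwards [this] with z hz hz'
    exact sub_eq_zero.1 (hz hz')
  intro φ h1 h2 h3
  have hφ : IsTestFunction Ω φ := ⟨h1, h2, h3⟩
  have e := (h.integral_eq φ hφ).symm.trans (h'.integral_eq φ hφ)
  have e' := mul_left_cancel₀ (pow_ne_zero (a + b) (by norm_num : (-1 : ℝ) ≠ 0)) e
  have hz : ∀ {k : ℝ × ℝ → ℝ}, LocallyIntegrableOn k Ω →
      Integrable (fun z => k z * φ z) (volume.restrict Ω) := by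
    intro k hk
    have hint := (hk.integrableOn_compact_subset h3 h2.isCompact)
    obtain ⟨C, hC⟩ := h1.continuous.bounded_above_of_compact_support h2
    have h4 : IntegrableOn (fun z => k z * φ z) (tsupport φ) :=
      Integrable.mul_bdd (c := C) hint h1.continuous.aestronglyMeasurable (.of_forall hC)
    exact ((integrableOn_iff_integrable_of_support_subset fun z hz =>
      subset_tsupport φ (right_ne_zero_of_mul hz)).1 h4).integrableOn
  rw [← setIntegral_eq_integral_of_forall_compl_eq_zero (s := Ω)]
  · simp only [Pi.sub_apply, smul_eq_mul, mul_comm (φ _), sub_mul]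
    rw [integral_sub (hz h.locInt_right) (hz h'.locInt_right), e', sub_self]
  · intro z hz'
    rw [image_eq_zero_of_notMem_tsupport fun h => hz' (h3 h), zero_smul]

lemma IsWeakDeriv.isWeakDeriv_weakDeriv {Ω : Set (ℝ × ℝ)} {a b : ℕ} {f g : ℝ × ℝ → ℝ}
    (h : IsWeakDeriv Ω a b f g) : IsWeakDeriv Ω a b f (weakDeriv Ω a b f) := by
  have h' : ∃ g, IsWeakDeriv Ω a b f g := ⟨g, h⟩
  rw [weakDeriv, dif_pos h']
  exact h'.choose_spec

lemma IsWeakDeriv.weakDeriv_ae_eq {Ω : Set (ℝ × ℝ)} (hΩ : IsOpen Ω) {a b : ℕ} {f g : ℝ × ℝ → ℝ}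
    (h : IsWeakDeriv Ω a b f g) : ∀ᵐ z ∂volume.restrict Ω, weakDeriv Ω a b f z = g z :=
  h.isWeakDeriv_weakDeriv.ae_eq hΩ h

lemma MemH.isWeakDeriv {Ω : Set (ℝ × ℝ)} {k : ℕ} {f : ℝ × ℝ → ℝ} (h : MemH Ω k f) {a b : ℕ}
    (hab : a + b ≤ k) : IsWeakDeriv Ω a b f (weakDeriv Ω a b f) := by
  obtain ⟨g, hg, -⟩ := h a b hab
  exact hg.isWeakDeriv_weakDeriv

lemma MemH.memLp {Ω : Set (ℝ × ℝ)} (hΩ : IsOpen Ω) {k : ℕ} {f : ℝ × ℝ → ℝ} (h : MemH Ω k f)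
    {a b : ℕ} (hab : a + b ≤ k) : MemLp (weakDeriv Ω a b f) 2 (volume.restrict Ω) := by
  obtain ⟨g, hg, hg'⟩ := h a b hab
  exact (memLp_congr_ae (hg.weakDeriv_ae_eq hΩ)).2 hg'

lemma isWeakDeriv_zero_zero {Ω : Set (ℝ × ℝ)} {f : ℝ × ℝ → ℝ} (h : LocallyIntegrableOn f Ω) :
    IsWeakDeriv Ω 0 0 f f :=
  ⟨h, h, fun φ _ => by simp⟩

/-! ### Exchange of the variables -/

lemma measurePreserving_swap : MeasurePreserving (Prod.swap : ℝ × ℝ → ℝ × ℝ) volume volume :=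
  Measure.measurePreserving_swap

lemma setIntegral_swap (Ω : Set (ℝ × ℝ)) (f : ℝ × ℝ → ℝ) :
    ∫ z in Prod.swap ⁻¹' Ω, f z.swap = ∫ z in Ω, f z :=
  measurePreserving_swap.setIntegral_preimage_emb
    (MeasurableEquiv.prodComm (α := ℝ) (β := ℝ)).measurableEmbedding f Ω

lemma measurePreserving_swap_restrict (Ω : Set (ℝ × ℝ)) :
    MeasurePreserving (Prod.swap : ℝ × ℝ → ℝ × ℝ) (volume.restrict (Prod.swap ⁻¹' Ω))
      (volume.restrict Ω) :=
  measurePreserving_swap.restrict_preimage_emb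
    (MeasurableEquiv.prodComm (α := ℝ) (β := ℝ)).measurableEmbedding Ω

lemma dy_comp_swap (φ : ℝ × ℝ → ℝ) : dy (φ ∘ Prod.swap) = dx φ ∘ Prod.swap := by
  ext z
  have := (ContinuousLinearEquiv.prodComm ℝ ℝ ℝ).comp_right_fderiv (f := φ) (x := z)
  have e : φ ∘ (ContinuousLinearEquiv.prodComm ℝ ℝ ℝ) = φ ∘ Prod.swap := rfl
  rw [e] at this
  simp only [dy, dx, this, Function.comp]
  rfl

lemma iterate_dy_comp_swap (k : ℕ) (φ : ℝ × ℝ → ℝ) :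
    dy^[k] (φ ∘ Prod.swap) = dx^[k] φ ∘ Prod.swap := by
  induction k generalizing φ with
  | zero => rfl
  | succ k ih => rw [Function.iterate_succ_apply, dy_comp_swap, ih, Function.iterate_succ_apply]

lemma IsTestFunction.comp_swap {Ω : Set (ℝ × ℝ)} {φ : ℝ × ℝ → ℝ}
    (h : IsTestFunction (Prod.swap ⁻¹' Ω) φ) : IsTestFunction Ω (φ ∘ Prod.swap) where
  smooth := h.smooth.comp (contDiff_snd.prodMk contDiff_fst)
  compact := h.compact.comp_homeomorph (Homeomorph.prodComm ℝ ℝ)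
  support_subset := by
    have : tsupport (φ ∘ Prod.swap) = Prod.swap ⁻¹' tsupport φ :=
      tsupport_comp_eq_preimage φ (Homeomorph.prodComm ℝ ℝ)
    rw [this]
    intro z hz
    simpa using h.support_subset hz

lemma locallyIntegrableOn_comp_swap {Ω : Set (ℝ × ℝ)} {f : ℝ × ℝ → ℝ}
    (h : LocallyIntegrableOn f Ω) : LocallyIntegrableOn (f ∘ Prod.swap) (Prod.swap ⁻¹' Ω) := by
  intro z hz
  obtain ⟨t, ht, ht'⟩ := h z.swap hz
  refine ⟨Prod.swap ⁻¹' t, ?_, ?_⟩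
  · exact (continuous_swap.continuousWithinAt.tendsto_nhdsWithin fun _ h => h) ht
  · exact (measurePreserving_swap.integrableOn_comp_preimage
      (MeasurableEquiv.prodComm (α := ℝ) (β := ℝ)).measurableEmbedding).2 ht'

/-- Weak derivatives in the second variable become weak derivatives in the first one. -/
lemma IsWeakDeriv.comp_swap {Ω : Set (ℝ × ℝ)} {k : ℕ} {f g : ℝ × ℝ → ℝ}
    (h : IsWeakDeriv Ω 0 k f g) :
    IsWeakDeriv (Prod.swap ⁻¹' Ω) k 0 (f ∘ Prod.swap) (g ∘ Prod.swap) := by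
  refine ⟨locallyIntegrableOn_comp_swap h.locInt_left,
    locallyIntegrableOn_comp_swap h.locInt_right, fun φ hφ => ?_⟩
  have := h.integral_eq _ hφ.comp_swap
  rw [iterate_dy_comp_swap, Function.iterate_zero, id, ← setIntegral_swap,
    ← setIntegral_swap Ω (fun z => g z * _)] at this
  simpa using this

/-- The superconvergence estimate on a rectangle, for the second component. -/
theorem abs_setIntegral_mul_affine_le_snd {Ω : Set (ℝ × ℝ)} {a b c d : ℝ} (hab : a < b)
    (hcd : c < d) (hΩ : Ioo a b ×ˢ Ioo c d ⊆ Ω) {v s τ : ℝ × ℝ → ℝ} {w : ℕ → ℝ × ℝ → ℝ}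
    (hw : ∀ k ≤ 4, IsWeakDeriv Ω 0 k v (w k))
    (hL : ∀ k ≤ 4, MemLp (w k) 2 (volume.restrict (Ioo a b ×ˢ Ioo c d)))
    {p q α β : ℝ}
    (hs : ∀ᵐ z ∂volume.restrict (Ioo a b ×ˢ Ioo c d), s z = p + q * z.2)
    (hτ : ∀ᵐ z ∂volume.restrict (Ioo a b ×ˢ Ioo c d), τ z = α + β * z.2)
    (hτL : MemLp τ 2 (volume.restrict (Ioo a b ×ˢ Ioo c d)))
    (hc : Tendsto (fun ε => ε⁻¹ * ∫ z in Ioo a b ×ˢ Ioo c (c + ε), (w 0 z - s z)) (𝓝[>] 0) (𝓝 0))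
    (hd : Tendsto (fun ε => ε⁻¹ * ∫ z in Ioo a b ×ˢ Ioo (d - ε) d, (w 0 z - s z))
      (𝓝[>] 0) (𝓝 0)) :
    |(∫ z in Ioo a b ×ˢ Ioo c d, (w 0 z - s z) * τ z)
        + (d - c) ^ 2 / 12 * ∫ z in Ioo a b ×ˢ Ioo c d, w 2 z * τ z|
      ≤ (d - c) ^ 4 *
        (√(∫ z in Ioo a b ×ˢ Ioo c d, w 4 z ^ 2) * √(∫ z in Ioo a b ×ˢ Ioo c d, τ z ^ 2)
          + √(∫ z in Ioo a b ×ˢ Ioo c d, w 3 z ^ 2) * √(∫ _ in Ioo a b ×ˢ Ioo c d, β ^ 2)) := by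
  have hpre : ∀ I J : Set ℝ, J ×ˢ I = Prod.swap ⁻¹' (I ×ˢ J) := fun I J =>
    (preimage_swap_prod I J).symm
  have hmp := measurePreserving_swap_restrict (Ioo a b ×ˢ Ioo c d)
  have hL' : ∀ {f : ℝ × ℝ → ℝ}, MemLp f 2 (volume.restrict (Ioo a b ×ˢ Ioo c d)) →
      MemLp (fun z => f z.swap) 2 (volume.restrict (Ioo c d ×ˢ Ioo a b)) := fun hf => by
    rw [hpre]
    exact hf.comp_measurePreserving hmp
  have hint : ∀ (I J : Set ℝ) (f : ℝ × ℝ → ℝ),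
      ∫ z in J ×ˢ I, f z.swap = ∫ z in I ×ˢ J, f z := fun I J f => by
    rw [hpre, setIntegral_swap]
  have key := abs_setIntegral_mul_affine_le (Ω := Prod.swap ⁻¹' Ω) hcd hab
    (v := v ∘ Prod.swap) (s := fun z => s z.swap) (τ := fun z => τ z.swap)
    (w := fun k z => w k z.swap) (p := p) (q := q) (α := α) (β := β)
    (by rw [hpre]; exact preimage_mono hΩ)
    (fun k hk => (hw k hk).comp_swap) (fun k hk => hL' (hL k hk))
    (by rw [hpre]; exact hmp.quasiMeasurePreserving.ae hs)
    (by rw [hpre]; exact hmp.quasiMeasurePreserving.ae hτ) (hL' hτL)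
    (hc.congr fun ε => by rw [← hint]) (hd.congr fun ε => by rw [← hint])
  rw [hint _ _ (fun z => (w 0 z - s z) * τ z), hint _ _ (fun z => w 2 z * τ z),
    hint _ _ (fun z => w 4 z ^ 2), hint _ _ (fun z => τ z ^ 2), hint _ _ (fun z => w 3 z ^ 2),
    hint _ _ (fun _ => β ^ 2)] at key
  exact key

/-! ### Weak derivatives of affine functions and of the potential -/

lemma IsTestFunction.dx {Ω : Set (ℝ × ℝ)} {φ : ℝ × ℝ → ℝ} (h : IsTestFunction Ω φ) :
    IsTestFunction Ω (dx φ) := by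
  have hs : tsupport (RRT.dx φ) ⊆ tsupport φ := tsupport_fderiv_apply_subset ℝ (1, 0)
  exact ⟨(h.smooth.fderiv_right (m := ∞) (by simp)).clm_apply contDiff_const,
    h.compact.isCompact.of_isClosed_subset (isClosed_tsupport _) hs, hs.trans h.support_subset⟩

lemma IsTestFunction.dy {Ω : Set (ℝ × ℝ)} {φ : ℝ × ℝ → ℝ} (h : IsTestFunction Ω φ) :
    IsTestFunction Ω (dy φ) := by
  have hs : tsupport (RRT.dy φ) ⊆ tsupport φ := tsupport_fderiv_apply_subset ℝ (0, 1)
  exact ⟨(h.smooth.fderiv_right (m := ∞) (by simp)).clm_apply contDiff_const,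
    h.compact.isCompact.of_isClosed_subset (isClosed_tsupport _) hs, hs.trans h.support_subset⟩

/-- If `∂ₓ u = -s`, then `∂ₓ³ u = -∂ₓ² s`. -/
lemma isWeakDeriv_three_zero {Ω : Set (ℝ × ℝ)} {u s w : ℝ × ℝ → ℝ}
    (hu : IsWeakDeriv Ω 1 0 u (fun z => -s z)) (hs : IsWeakDeriv Ω 2 0 s w) :
    IsWeakDeriv Ω 3 0 u (fun z => -w z) := by
  refine ⟨hu.locInt_left, hs.locInt_right.neg, fun φ hφ => ?_⟩
  have e1 := hu.integral_eq _ hφ.dx.dx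
  have e2 := hs.integral_eq _ hφ
  simp only [Function.iterate_succ, Function.iterate_zero, Function.comp, id, neg_mul,
    integral_neg] at e1 e2 ⊢
  rw [e1, e2]
  ring

/-- If `∂ᵧ u = -s`, then `∂ᵧ³ u = -∂ᵧ² s`. -/
lemma isWeakDeriv_zero_three {Ω : Set (ℝ × ℝ)} {u s w : ℝ × ℝ → ℝ}
    (hu : IsWeakDeriv Ω 0 1 u (fun z => -s z)) (hs : IsWeakDeriv Ω 0 2 s w) :
    IsWeakDeriv Ω 0 3 u (fun z => -w z) := by
  refine ⟨hu.locInt_left, hs.locInt_right.neg, fun φ hφ => ?_⟩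
  have e1 := hu.integral_eq _ hφ.dy.dy
  have e2 := hs.integral_eq _ hφ
  simp only [Function.iterate_succ, Function.iterate_zero, Function.comp, id, neg_mul,
    integral_neg] at e1 e2 ⊢
  rw [e1, e2]
  ring

lemma IsTestFunction.integral_affine_mul_fderiv {U : Set (ℝ × ℝ)} {φ : ℝ × ℝ → ℝ}
    (h : IsTestFunction U φ) (α : ℝ) (L : ℝ × ℝ →L[ℝ] ℝ) (e : ℝ × ℝ) :
    ∫ z in U, (α + L z) * fderiv ℝ φ z e = -∫ z in U, L e * φ z := by
  have hcφ : Continuous φ := h.smooth.continuous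
  have hcφ' : Continuous fun z => fderiv ℝ φ z e :=
    (h.smooth.continuous_fderiv (by simp)).clm_apply continuous_const
  have hsφ' : HasCompactSupport fun z => fderiv ℝ φ z e := h.compact.fderiv_apply ℝ e
  have hd : ∀ z, fderiv ℝ (fun z => α + L z) z = L := fun z =>
    (L.hasFDerivAt.const_add α).fderiv
  have h0 : ∀ z, z ∉ U → φ z = 0 := fun z hz =>
    image_eq_zero_of_notMem_tsupport fun hz' => hz (h.support_subset hz')
  have h0' : ∀ z, z ∉ U → fderiv ℝ φ z e = 0 := fun z hz =>
    image_eq_zero_of_notMem_tsupport (f := fun z => fderiv ℝ φ z e) fun hz' =>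
      hz (h.support_subset (tsupport_fderiv_apply_subset ℝ e hz'))
  have key := integral_mul_fderiv_eq_neg_fderiv_mul_of_integrable (𝕜 := ℝ) (μ := volume) (v := e)
    (f := fun z => α + L z) (g := φ) (by
      simp only [hd]
      exact (continuous_const.mul hcφ).integrable_of_hasCompactSupport h.compact.mul_left) (by
      exact (Continuous.mul (by fun_prop) hcφ').integrable_of_hasCompactSupport hsφ'.mul_left) (by
      exact (Continuous.mul (by fun_prop) hcφ).integrable_of_hasCompactSupport h.compact.mul_left)
    (fun _ _ => by fun_prop) (fun z _ => h.smooth.differentiable (by simp) z)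
  simp only [hd] at key
  rw [setIntegral_eq_integral_of_forall_compl_eq_zero fun z hz => by rw [h0' z hz, mul_zero], key,
    setIntegral_eq_integral_of_forall_compl_eq_zero fun z hz => by rw [h0 z hz, mul_zero]]

lemma isWeakDeriv_of_ae_eq_affine_fst {U : Set (ℝ × ℝ)} {f : ℝ × ℝ → ℝ} (hfi : IntegrableOn f U)
    {α β : ℝ} (hf : ∀ᵐ z ∂volume.restrict U, f z = α + β * z.1) :
    IsWeakDeriv U 1 0 f (fun _ => β) := by
  refine ⟨hfi.locallyIntegrableOn, (continuous_const.locallyIntegrable).locallyIntegrableOn U,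
    fun φ hφ => ?_⟩
  have := hφ.integral_affine_mul_fderiv α (β • ContinuousLinearMap.fst ℝ ℝ ℝ) (1, 0)
  simp only [_root_.smul_apply, ContinuousLinearMap.coe_fst', smul_eq_mul,
    mul_one] at this
  simp only [Function.iterate_succ, Function.iterate_zero, Function.comp, id, RRT.dx]
  rw [integral_congr_ae (g := fun z => (α + β * z.1) * fderiv ℝ φ z (1, 0)), this]
  · ring
  · filter_upwards [hf] with z hz
    rw [hz]

lemma isWeakDeriv_of_ae_eq_affine_snd {U : Set (ℝ × ℝ)} {f : ℝ × ℝ → ℝ} (hfi : IntegrableOn f U)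
    {α β : ℝ} (hf : ∀ᵐ z ∂volume.restrict U, f z = α + β * z.2) :
    IsWeakDeriv U 0 1 f (fun _ => β) := by
  refine ⟨hfi.locallyIntegrableOn, (continuous_const.locallyIntegrable).locallyIntegrableOn U,
    fun φ hφ => ?_⟩
  have := hφ.integral_affine_mul_fderiv α (β • ContinuousLinearMap.snd ℝ ℝ ℝ) (0, 1)
  simp only [_root_.smul_apply, ContinuousLinearMap.coe_snd', smul_eq_mul,
    mul_one] at this
  simp only [Function.iterate_succ, Function.iterate_zero, Function.comp, id, RRT.dy]
  rw [integral_congr_ae (g := fun z => (α + β * z.2) * fderiv ℝ φ z (0, 1)), this]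
  · ring
  · filter_upwards [hf] with z hz
    rw [hz]

/-! ### Parts of the Sobolev norms -/

lemma setIntegral_sq_nonneg (U : Set (ℝ × ℝ)) (f : ℝ × ℝ → ℝ) : 0 ≤ ∫ z in U, f z ^ 2 :=
  integral_nonneg fun _ => sq_nonneg _

/-- Two derivatives of consecutive orders contribute separately to the Sobolev norm. -/
lemma add_le_normHSq {U : Set (ℝ × ℝ)} {k m : ℕ} {f : ℝ × ℝ → ℝ} (hm : m < k)
    {α β : ℕ × ℕ} (hα : α.1 + α.2 = m) (hβ : β.1 + β.2 = m + 1) :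
    (∫ z in U, weakDeriv U α.1 α.2 f z ^ 2) + ∫ z in U, weakDeriv U β.1 β.2 f z ^ 2
      ≤ normHSq U k f := by
  have hn : ∀ γ : ℕ × ℕ, 0 ≤ ∫ z in U, weakDeriv U γ.1 γ.2 f z ^ 2 := fun γ =>
    setIntegral_sq_nonneg U _
  have h1 : ∀ n (γ : ℕ × ℕ), γ.1 + γ.2 = n → ∫ z in U, weakDeriv U γ.1 γ.2 f z ^ 2
      ≤ ∑ γ ∈ Finset.HasAntidiagonal.antidiagonal n, ∫ z in U, weakDeriv U γ.1 γ.2 f z ^ 2 :=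
    fun n γ hγ => Finset.single_le_sum
      (f := fun γ : ℕ × ℕ => ∫ z in U, weakDeriv U γ.1 γ.2 f z ^ 2) (fun γ _ => hn γ)
      (Finset.HasAntidiagonal.mem_antidiagonal.2 hγ)
  refine (add_le_add (h1 m α hα) (h1 (m + 1) β hβ)).trans ?_
  have hsub : ({m, m + 1} : Finset ℕ) ⊆ Finset.range (k + 1) := by
    intro n hn
    simp only [Finset.mem_insert, Finset.mem_singleton] at hn
    rw [Finset.mem_range]
    omega
  refine le_trans (le_of_eq ?_) (Finset.sum_le_sum_of_subset_of_nonneg hsub fun n _ _ =>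
    Finset.sum_nonneg fun γ _ => hn γ)
  rw [Finset.sum_pair (by omega)]

lemma integral_sq_add_integral_sq_le_normHSq {U : Set (ℝ × ℝ)} (hU : IsOpen U)
    {f g : ℝ × ℝ → ℝ} {α : ℕ × ℕ} (hα : α.1 + α.2 = 1) (hg : IsWeakDeriv U α.1 α.2 f g) :
    (∫ z in U, f z ^ 2) + ∫ z in U, g z ^ 2 ≤ normHSq U 1 f := by
  refine le_trans (le_of_eq ?_) (add_le_normHSq (f := f) (k := 1) one_pos (α := (0, 0)) rfl hα)
  congr 1
  · refine integral_congr_ae ?_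
    filter_upwards [(isWeakDeriv_zero_zero hg.locInt_left).weakDeriv_ae_eq hU] with z hz
    rw [hz]
  · refine integral_congr_ae ?_
    filter_upwards [hg.weakDeriv_ae_eq hU] with z hz
    rw [hz]

/-! ### Rectangles of the mesh -/

namespace Grid

variable (G : Grid)

lemma x_lt (i : Fin G.n₁) : G.x i.castSucc < G.x i.succ := G.x_strictMono i.castSucc_lt_succ

lemma y_lt (j : Fin G.n₂) : G.y j.castSucc < G.y j.succ := G.y_strictMono j.castSucc_lt_succ

lemma isOpen_openCell (K : Fin G.n₁ × Fin G.n₂) : IsOpen (G.openCell K) :=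
  isOpen_Ioo.prod isOpen_Ioo

lemma volume_openCell_lt_top (K : Fin G.n₁ × Fin G.n₂) : volume (G.openCell K) < ⊤ :=
  ((Metric.isBounded_Ioo _ _).prod (Metric.isBounded_Ioo _ _)).measure_lt_top

lemma openCell_ae_eq_cell (K : Fin G.n₁ × Fin G.n₂) : G.openCell K =ᵐ[volume] G.cell K :=
  Measure.set_prod_ae_eq Ioo_ae_eq_Icc Ioo_ae_eq_Icc

lemma openCell_subset_cell (K : Fin G.n₁ × Fin G.n₂) : G.openCell K ⊆ G.cell K :=
  prod_mono Ioo_subset_Icc_self Ioo_subset_Icc_self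

lemma disjoint_Ioo_of_ne {n : ℕ} {x : Fin (n + 1) → ℝ} (hx : StrictMono x) {i j : Fin n}
    (hij : i ≠ j) :
    Disjoint (Ioo (x i.castSucc) (x i.succ)) (Ioo (x j.castSucc) (x j.succ)) := by
  wlog h : i < j generalizing i j
  · exact (this hij.symm (lt_of_le_of_ne (not_lt.1 h) hij.symm)).symm
  have : x i.succ ≤ x j.castSucc := hx.monotone (Fin.succ_le_castSucc_iff.2 h)
  exact disjoint_left.2 fun t ht ht' => by linarith [ht.2, ht'.1]

lemma disjoint_openCell {K K' : Fin G.n₁ × Fin G.n₂} (h : K ≠ K') :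
    Disjoint (G.openCell K) (G.openCell K') := by
  by_cases h1 : K.1 = K'.1
  · have h2 : K.2 ≠ K'.2 := fun h2 => h (Prod.ext h1 h2)
    exact disjoint_prod.2 (Or.inr (disjoint_Ioo_of_ne G.y_strictMono h2))
  · exact disjoint_prod.2 (Or.inl (disjoint_Ioo_of_ne G.x_strictMono h1))

variable {G} {Ω : Set (ℝ × ℝ)}

/-- The open rectangles of the mesh fill `Ω` up to a null set. -/
lemma Divides.iUnion_openCell_ae_eq (hG : G.Divides Ω) :
    (⋃ K ∈ G.mesh Ω, G.openCell K : Set (ℝ × ℝ)) =ᵐ[volume] Ω := by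
  refine Filter.EventuallyLE.antisymm (LE.le.eventuallyLE (iUnion₂_subset hG.2)) ?_
  have h1 : Ω ≤ᵐ[volume] (⋃ K ∈ G.mesh Ω, G.cell K : Set (ℝ × ℝ)) :=
    LE.le.eventuallyLE (hG.1 ▸ subset_closure)
  refine h1.trans (EventuallyEq.le ?_)
  have h2 : ∀ᵐ z : ℝ × ℝ, ∀ K : Fin G.n₁ × Fin G.n₂, z ∈ G.openCell K ↔ z ∈ G.cell K :=
    ae_all_iff.2 fun K => (G.openCell_ae_eq_cell K).mem_iff
  refine eventuallyEq_set.2 ?_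
  filter_upwards [h2] with z hz
  simp only [mem_iUnion, hz]

lemma Divides.setIntegral_eq_sum (hG : G.Divides Ω) {f : ℝ × ℝ → ℝ} (hf : IntegrableOn f Ω) :
    ∫ z in Ω, f z = ∑ K ∈ G.mesh Ω, ∫ z in G.openCell K, f z := by
  rw [← setIntegral_congr_set hG.iUnion_openCell_ae_eq]
  exact integral_biUnion_finset _ (fun K _ => (G.isOpen_openCell K).measurableSet)
    (fun K _ K' _ h => G.disjoint_openCell h) fun K hK => hf.mono_set (hG.2 K hK)

lemma hx_le_meshSize {K : Fin G.n₁ × Fin G.n₂} (hK : K ∈ G.mesh Ω) : G.hx K.1 ≤ G.meshSize Ω :=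
  (le_max_left _ _).trans (le_ciSup
    (f := fun K : {K // K ∈ G.mesh Ω} => max (G.hx K.1.1) (G.hy K.1.2))
    (finite_range _).bddAbove ⟨K, hK⟩)

lemma hy_le_meshSize {K : Fin G.n₁ × Fin G.n₂} (hK : K ∈ G.mesh Ω) : G.hy K.2 ≤ G.meshSize Ω :=
  (le_max_right _ _).trans (le_ciSup
    (f := fun K : {K // K ∈ G.mesh Ω} => max (G.hx K.1.1) (G.hy K.1.2))
    (finite_range _).bddAbove ⟨K, hK⟩)

section Flux

variable {K : Fin G.n₁ × Fin G.n₂} {w : ℝ × ℝ → ℝ × ℝ}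

/-- The flux through the left edge in terms of the first component. Here and for the other edges
the strip of width `ε` is a rectangle only when `ε` is smaller than the element. -/
lemma HasEdgeFlux.left (h : G.HasEdgeFlux K .left w 0) :
    Tendsto (fun ε => ε⁻¹ * ∫ z in Ioo (G.x K.1.castSucc) (G.x K.1.castSucc + ε) ×ˢ
      Ioo (G.y K.2.castSucc) (G.y K.2.succ), (w z).1) (𝓝[>] 0) (𝓝 0) := by
  have h' := h.neg
  rw [neg_zero] at h'
  refine h'.congr' ?_
  filter_upwards [eventually_pos_and_lt (sub_pos.2 (G.x_lt K.1))] with ε hε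
  have : G.strip K ε .left = Ioo (G.x K.1.castSucc) (G.x K.1.castSucc + ε) ×ˢ
      Ioo (G.y K.2.castSucc) (G.y K.2.succ) := by
    ext z
    simp only [strip, openCell, mem_inter_iff, mem_prod, mem_Ioo, mem_ofPred_eq]
    constructor
    · rintro ⟨⟨⟨h1, h2⟩, h3⟩, h4⟩
      exact ⟨⟨h1, h4⟩, h3⟩
    · rintro ⟨⟨h1, h2⟩, h3⟩
      exact ⟨⟨⟨h1, by linarith⟩, h3⟩, h2⟩
  simp [this, dot, Side.normal, integral_neg]

lemma HasEdgeFlux.right (h : G.HasEdgeFlux K .right w 0) :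
    Tendsto (fun ε => ε⁻¹ * ∫ z in Ioo (G.x K.1.succ - ε) (G.x K.1.succ) ×ˢ
      Ioo (G.y K.2.castSucc) (G.y K.2.succ), (w z).1) (𝓝[>] 0) (𝓝 0) := by
  refine h.congr' ?_
  filter_upwards [eventually_pos_and_lt (sub_pos.2 (G.x_lt K.1))] with ε hε
  have : G.strip K ε .right = Ioo (G.x K.1.succ - ε) (G.x K.1.succ) ×ˢ
      Ioo (G.y K.2.castSucc) (G.y K.2.succ) := by
    ext z
    simp only [strip, openCell, mem_inter_iff, mem_prod, mem_Ioo, mem_ofPred_eq]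
    constructor
    · rintro ⟨⟨⟨h1, h2⟩, h3⟩, h4⟩
      exact ⟨⟨h4, h2⟩, h3⟩
    · rintro ⟨⟨h1, h2⟩, h3⟩
      exact ⟨⟨⟨by linarith, h2⟩, h3⟩, h1⟩
  simp [this, dot, Side.normal]

lemma HasEdgeFlux.bottom (h : G.HasEdgeFlux K .bottom w 0) :
    Tendsto (fun ε => ε⁻¹ * ∫ z in Ioo (G.x K.1.castSucc) (G.x K.1.succ) ×ˢ
      Ioo (G.y K.2.castSucc) (G.y K.2.castSucc + ε), (w z).2) (𝓝[>] 0) (𝓝 0) := by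
  have h' := h.neg
  rw [neg_zero] at h'
  refine h'.congr' ?_
  filter_upwards [eventually_pos_and_lt (sub_pos.2 (G.y_lt K.2))] with ε hε
  have : G.strip K ε .bottom = Ioo (G.x K.1.castSucc) (G.x K.1.succ) ×ˢ
      Ioo (G.y K.2.castSucc) (G.y K.2.castSucc + ε) := by
    ext z
    simp only [strip, openCell, mem_inter_iff, mem_prod, mem_Ioo, mem_ofPred_eq]
    constructor
    · rintro ⟨⟨h3, ⟨h1, h2⟩⟩, h4⟩
      exact ⟨h3, h1, h4⟩
    · rintro ⟨h3, h1, h2⟩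
      exact ⟨⟨h3, h1, by linarith⟩, h2⟩
  simp [this, dot, Side.normal, integral_neg]

lemma HasEdgeFlux.top (h : G.HasEdgeFlux K .top w 0) :
    Tendsto (fun ε => ε⁻¹ * ∫ z in Ioo (G.x K.1.castSucc) (G.x K.1.succ) ×ˢ
      Ioo (G.y K.2.succ - ε) (G.y K.2.succ), (w z).2) (𝓝[>] 0) (𝓝 0) := by
  refine h.congr' ?_
  filter_upwards [eventually_pos_and_lt (sub_pos.2 (G.y_lt K.2))] with ε hε
  have : G.strip K ε .top = Ioo (G.x K.1.castSucc) (G.x K.1.succ) ×ˢ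
      Ioo (G.y K.2.succ - ε) (G.y K.2.succ) := by
    ext z
    simp only [strip, openCell, mem_inter_iff, mem_prod, mem_Ioo, mem_ofPred_eq]
    constructor
    · rintro ⟨⟨h3, ⟨h1, h2⟩⟩, h4⟩
      exact ⟨h3, h4, h2⟩
    · rintro ⟨h3, h1, h2⟩
      exact ⟨⟨h3, by linarith, h2⟩, h1⟩
  simp [this, dot, Side.normal]

end Flux

end Grid

/-! ### The estimate on an element and the sum over the mesh -/

/-- The part of the square of the `H⁴` norm of `σ` that enters the estimate on `U`. -/
def superNormSq (Ω U : Set (ℝ × ℝ)) (σ : ℝ × ℝ → ℝ × ℝ) : ℝ :=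
  ((∫ z in U, weakDeriv Ω 4 0 (fun p => (σ p).1) z ^ 2)
    + ∫ z in U, weakDeriv Ω 3 0 (fun p => (σ p).1) z ^ 2)
  + ((∫ z in U, weakDeriv Ω 0 4 (fun p => (σ p).2) z ^ 2)
    + ∫ z in U, weakDeriv Ω 0 3 (fun p => (σ p).2) z ^ 2)

lemma superNormSq_nonneg (Ω U : Set (ℝ × ℝ)) (σ : ℝ × ℝ → ℝ × ℝ) : 0 ≤ superNormSq Ω U σ := by
  have := setIntegral_sq_nonneg U
  exact add_nonneg (add_nonneg (this _) (this _)) (add_nonneg (this _) (this _))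

lemma superNormSq_le (Ω : Set (ℝ × ℝ)) (σ : ℝ × ℝ → ℝ × ℝ) :
    superNormSq Ω Ω σ ≤ vecNormHSq Ω 4 σ := by
  refine add_le_add ?_ ?_
  · rw [add_comm]
    exact add_le_normHSq (m := 3) (k := 4) (by norm_num) (α := (3, 0)) (β := (4, 0)) rfl rfl
  · rw [add_comm]
    exact add_le_normHSq (m := 3) (k := 4) (by norm_num) (α := (0, 3)) (β := (0, 4)) rfl rfl

lemma sum_four_sqrt_mul_sqrt_le {a₁ a₂ a₃ a₄ b₁ b₂ b₃ b₄ : ℝ} (ha₁ : 0 ≤ a₁) (ha₂ : 0 ≤ a₂)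
    (ha₃ : 0 ≤ a₃) (ha₄ : 0 ≤ a₄) (hb₁ : 0 ≤ b₁) (hb₂ : 0 ≤ b₂) (hb₃ : 0 ≤ b₃) (hb₄ : 0 ≤ b₄) :
    (√a₁ * √b₁ + √a₂ * √b₂) + (√a₃ * √b₃ + √a₄ * √b₄)
      ≤ √((a₁ + a₂) + (a₃ + a₄)) * √((b₁ + b₂) + (b₃ + b₄)) := by
  have h := Real.sum_sqrt_mul_sqrt_le Finset.univ (f := ![a₁, a₂, a₃, a₄])
    (g := ![b₁, b₂, b₃, b₄]) (by intro i; fin_cases i <;> simpa)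
    (by intro i; fin_cases i <;> simpa)
  simpa [Fin.sum_univ_four, add_assoc] using h

/-- A function together with its pure weak derivatives in the first variable. -/
def derivsFst (Ω : Set (ℝ × ℝ)) (f : ℝ × ℝ → ℝ) : ℕ → ℝ × ℝ → ℝ
  | 0 => f
  | k + 1 => weakDeriv Ω (k + 1) 0 f

/-- A function together with its pure weak derivatives in the second variable. -/
def derivsSnd (Ω : Set (ℝ × ℝ)) (f : ℝ × ℝ → ℝ) : ℕ → ℝ × ℝ → ℝ
  | 0 => f
  | k + 1 => weakDeriv Ω 0 (k + 1) f

lemma MemH.isWeakDeriv_zero_zero {Ω : Set (ℝ × ℝ)} {k : ℕ} {f : ℝ × ℝ → ℝ} (h : MemH Ω k f) :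
    IsWeakDeriv Ω 0 0 f f :=
  RRT.isWeakDeriv_zero_zero (h.isWeakDeriv (a := 0) (b := 0) (by simp)).locInt_left

lemma MemH.memLp_self {Ω : Set (ℝ × ℝ)} (hΩ : IsOpen Ω) {k : ℕ} {f : ℝ × ℝ → ℝ}
    (h : MemH Ω k f) : MemLp f 2 (volume.restrict Ω) :=
  (memLp_congr_ae (h.isWeakDeriv_zero_zero.weakDeriv_ae_eq hΩ)).1
    (h.memLp hΩ (a := 0) (b := 0) (by simp))

/-- The superconvergence estimate on an element, for both components. -/
theorem abs_openCell_error_le {Ω : Set (ℝ × ℝ)} (hΩ : IsOpen Ω) {σ σI τ : ℝ × ℝ → ℝ × ℝ}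
    (hσ : VecMemH Ω 4 σ) {G : Grid} (hG : G.Divides Ω) (hI : G.IsInterpolation Ω σ σI)
    (hτ : G.MemRT Ω τ) {K : Fin G.n₁ × Fin G.n₂} (hK : K ∈ G.mesh Ω) :
    |((∫ z in G.openCell K, ((σ z).1 - (σI z).1) * (τ z).1)
        + G.hx K.1 ^ 2 / 12
          * ∫ z in G.openCell K, weakDeriv Ω 2 0 (fun p => (σ p).1) z * (τ z).1)
      + ((∫ z in G.openCell K, ((σ z).2 - (σI z).2) * (τ z).2)
        + G.hy K.2 ^ 2 / 12
          * ∫ z in G.openCell K, weakDeriv Ω 0 2 (fun p => (σ p).2) z * (τ z).2)|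
      ≤ G.meshSize Ω ^ 4 *
        (√(superNormSq Ω (G.openCell K) σ) * √(vecNormHSq (G.openCell K) 1 τ)) := by
  have hR := hG.2 K hK
  have hmono : volume.restrict (G.openCell K) ≤ volume.restrict Ω :=
    Measure.restrict_mono hR le_rfl
  have hfin : IsFiniteMeasure (volume.restrict (G.openCell K)) :=
    isFiniteMeasure_restrict.2 (G.volume_openCell_lt_top K).ne
  obtain ⟨p, q, p', q', hs⟩ := hI.1.2 K hK
  obtain ⟨α, β, α', β', ht⟩ := hτ.2 K hK
  have hs := ae_restrict_of_ae_restrict_of_subset (G.openCell_subset_cell K) hs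
  have ht := ae_restrict_of_ae_restrict_of_subset (G.openCell_subset_cell K) ht
  have hτ1 : MemLp (fun z => (τ z).1) 2 (volume.restrict (G.openCell K)) :=
    hτ.1.1.mono_measure hmono
  have hτ2 : MemLp (fun z => (τ z).2) 2 (volume.restrict (G.openCell K)) :=
    hτ.1.2.1.mono_measure hmono
  have ht1 : ∀ᵐ z ∂volume.restrict (G.openCell K), (τ z).1 = α + β * z.1 := by
    filter_upwards [ht] with z hz
    rw [hz]
  have ht2 : ∀ᵐ z ∂volume.restrict (G.openCell K), (τ z).2 = α' + β' * z.2 := by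
    filter_upwards [ht] with z hz
    rw [hz]
  have e1 := abs_setIntegral_mul_affine_le (G.x_lt K.1) (G.y_lt K.2) hR
    (v := fun p => (σ p).1) (s := fun z => (σI z).1) (τ := fun z => (τ z).1)
    (w := derivsFst Ω fun p => (σ p).1) (p := p) (q := q) (α := α) (β := β)
    (fun k hk => by
      cases k with
      | zero => exact hσ.1.isWeakDeriv_zero_zero
      | succ k => exact hσ.1.isWeakDeriv hk)
    (fun k hk => by
      cases k with
      | zero => exact (hσ.1.memLp_self hΩ).mono_measure hmono
      | succ k => exact (hσ.1.memLp hΩ (a := k + 1) (b := 0) hk).mono_measure hmono)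
    (by filter_upwards [hs] with z hz; rw [hz]) ht1 hτ1
    (hI.2 K hK .left).left (hI.2 K hK .right).right
  have e2 := abs_setIntegral_mul_affine_le_snd (G.x_lt K.1) (G.y_lt K.2) hR
    (v := fun p => (σ p).2) (s := fun z => (σI z).2) (τ := fun z => (τ z).2)
    (w := derivsSnd Ω fun p => (σ p).2) (p := p') (q := q') (α := α') (β := β')
    (fun k hk => by
      cases k with
      | zero => exact hσ.2.isWeakDeriv_zero_zero
      | succ k => exact hσ.2.isWeakDeriv (by simpa using hk))
    (fun k hk => by
      cases k with
      | zero => exact (hσ.2.memLp_self hΩ).mono_measure hmono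
      | succ k => exact (hσ.2.memLp hΩ (a := 0) (b := k + 1) (by simpa using hk)).mono_measure hmono)
    (by filter_upwards [hs] with z hz; rw [hz]) ht2 hτ2
    (hI.2 K hK .bottom).bottom (hI.2 K hK .top).top
  have hx0 : 0 ≤ G.hx K.1 := (sub_pos.2 (G.x_lt K.1)).le
  have hy0 : 0 ≤ G.hy K.2 := (sub_pos.2 (G.y_lt K.2)).le
  have hx4 := pow_le_pow_left₀ hx0 (Grid.hx_le_meshSize hK) 4
  have hy4 := pow_le_pow_left₀ hy0 (Grid.hy_le_meshSize hK) 4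
  have n1 := integral_sq_add_integral_sq_le_normHSq (G.isOpen_openCell K) (α := (1, 0)) rfl
    (isWeakDeriv_of_ae_eq_affine_fst (hτ1.integrable one_le_two) ht1)
  have n2 := integral_sq_add_integral_sq_le_normHSq (G.isOpen_openCell K) (α := (0, 1)) rfl
    (isWeakDeriv_of_ae_eq_affine_snd (hτ2.integrable one_le_two) ht2)
  have hn := setIntegral_sq_nonneg (G.openCell K)
  refine (abs_add_le _ _).trans ((add_le_add e1 e2).trans ((add_le_add
    (mul_le_mul_of_nonneg_right hx4 (by positivity))
    (mul_le_mul_of_nonneg_right hy4 (by positivity))).trans ?_))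
  rw [← mul_add]
  have hm : 0 ≤ G.meshSize Ω ^ 4 := (pow_nonneg hx0 4).trans hx4
  refine mul_le_mul_of_nonneg_left ((sum_four_sqrt_mul_sqrt_le (hn _) (hn _) (hn _) (hn _)
    (hn _) (hn _) (hn _) (hn _)).trans ?_) hm
  exact mul_le_mul_of_nonneg_left (Real.sqrt_le_sqrt (add_le_add n1 n2)) (Real.sqrt_nonneg _)

lemma Grid.Divides.sum_superNormSq {Ω : Set (ℝ × ℝ)} (hΩ : IsOpen Ω) {σ : ℝ × ℝ → ℝ × ℝ}
    (hσ : VecMemH Ω 4 σ) {G : Grid} (hG : G.Divides Ω) :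
    ∑ K ∈ G.mesh Ω, superNormSq Ω (G.openCell K) σ = superNormSq Ω Ω σ := by
  have h : ∀ {f : ℝ × ℝ → ℝ}, MemLp f 2 (volume.restrict Ω) →
      ∑ K ∈ G.mesh Ω, ∫ z in G.openCell K, f z ^ 2 = ∫ z in Ω, f z ^ 2 := fun hf =>
    (hG.setIntegral_eq_sum hf.integrable_sq).symm
  simp only [superNormSq, Finset.sum_add_distrib]
  rw [h (hσ.1.memLp hΩ (by norm_num)), h (hσ.1.memLp hΩ (by norm_num)),
    h (hσ.2.memLp hΩ (by norm_num)), h (hσ.2.memLp hΩ (by norm_num))]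

/-- The third derivatives of the potential in the expansion are, up to the sign, second derivatives
of `σ`. -/
lemma setIntegral_cell_weakDeriv_potential {Ω : Set (ℝ × ℝ)} (hΩ : IsOpen Ω) {G : Grid}
    {K : Fin G.n₁ × Fin G.n₂} (hK : G.openCell K ⊆ Ω) {a b : ℕ} {u w t : ℝ × ℝ → ℝ}
    (hu : IsWeakDeriv Ω a b u fun z => -w z) :
    ∫ z in G.cell K, weakDeriv Ω a b u z * t z = -∫ z in G.openCell K, w z * t z := by
  rw [← setIntegral_congr_set (G.openCell_ae_eq_cell K), ← integral_neg]
  refine integral_congr_ae ?_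
  filter_upwards [ae_restrict_of_ae_restrict_of_subset hK (hu.weakDeriv_ae_eq hΩ)] with z hz
  rw [hz, neg_mul]

end RRT

end

theorem mainTheorem6 :
    ∃ C : ℝ, ∀ (Ω : Set (ℝ × ℝ)), IsOpen Ω → IsConnected Ω →
      ∀ (u : ℝ × ℝ → ℝ) (σ : ℝ × ℝ → ℝ × ℝ),
        RRT.IsWeakGrad Ω u (fun p => -σ p) → RRT.VecMemH Ω 4 σ →
      ∀ G : RRT.Grid, G.Divides Ω →
      ∀ σI : ℝ × ℝ → ℝ × ℝ, G.IsInterpolation Ω σ σI →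
      ∀ τ : ℝ × ℝ → ℝ × ℝ, G.MemRT Ω τ →
        |RRT.innerL2 Ω (fun p => σ p - σI p) τ
            - 1 / 12 * ∑ K ∈ G.mesh Ω,
              (G.hx K.1 ^ 2 * (∫ p in G.cell K, RRT.weakDeriv Ω 3 0 u p * (τ p).1)
                + G.hy K.2 ^ 2 * (∫ p in G.cell K, RRT.weakDeriv Ω 0 3 u p * (τ p).2))|
          ≤ C * G.meshSize Ω ^ 4 * RRT.vecNormH Ω 4 σ * G.brokenNormH1 Ω τ := by
  refine ⟨1, fun Ω hΩ _ u σ hu hσ G hG σI hI τ hτ => ?_⟩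
  have i1 : IntegrableOn (fun z => ((σ z).1 - (σI z).1) * (τ z).1) Ω :=
    ((hσ.1.memLp_self hΩ).sub hI.1.1.1).integrable_mul hτ.1.1
  have i2 : IntegrableOn (fun z => ((σ z).2 - (σI z).2) * (τ z).2) Ω :=
    ((hσ.2.memLp_self hΩ).sub hI.1.1.2.1).integrable_mul hτ.1.2.1
  have hinner : RRT.innerL2 Ω (fun p => σ p - σI p) τ
      = ∑ K ∈ G.mesh Ω, ((∫ z in G.openCell K, ((σ z).1 - (σI z).1) * (τ z).1)
          + ∫ z in G.openCell K, ((σ z).2 - (σI z).2) * (τ z).2) := by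
    rw [Finset.sum_add_distrib, ← hG.setIntegral_eq_sum i1, ← hG.setIntegral_eq_sum i2,
      ← integral_add i1 i2]
    rfl
  have h3 := RRT.isWeakDeriv_three_zero hu.1 (hσ.1.isWeakDeriv (a := 2) (b := 0) (by norm_num))
  have h3' := RRT.isWeakDeriv_zero_three hu.2 (hσ.2.isWeakDeriv (a := 0) (b := 2) (by norm_num))
  rw [hinner, Finset.mul_sum, ← Finset.sum_sub_distrib]
  calc _ ≤ ∑ K ∈ G.mesh Ω, G.meshSize Ω ^ 4 * (√(RRT.superNormSq Ω (G.openCell K) σ)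
        * √(RRT.vecNormHSq (G.openCell K) 1 τ)) := by
        refine (Finset.abs_sum_le_sum_abs _ _).trans (Finset.sum_le_sum fun K hK => ?_)
        refine le_trans (le_of_eq ?_) (RRT.abs_openCell_error_le hΩ hσ hG hI hτ hK)
        rw [RRT.setIntegral_cell_weakDeriv_potential hΩ (hG.2 K hK) h3,
          RRT.setIntegral_cell_weakDeriv_potential hΩ (hG.2 K hK) h3']
        congr 1
        ring
    _ ≤ G.meshSize Ω ^ 4 * (√(∑ K ∈ G.mesh Ω, RRT.superNormSq Ω (G.openCell K) σ)
        * √(∑ K ∈ G.mesh Ω, RRT.vecNormHSq (G.openCell K) 1 τ)) := by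
        rw [← Finset.mul_sum]
        refine mul_le_mul_of_nonneg_left (Real.sum_sqrt_mul_sqrt_le _
          (fun K => RRT.superNormSq_nonneg _ _ _) fun K => ?_) (by positivity)
        refine add_nonneg ?_ ?_ <;>
        exact Finset.sum_nonneg fun m _ => Finset.sum_nonneg fun α _ =>
          RRT.setIntegral_sq_nonneg _ _
    _ ≤ 1 * G.meshSize Ω ^ 4 * RRT.vecNormH Ω 4 σ * G.brokenNormH1 Ω τ := by
        rw [hG.sum_superNormSq hΩ hσ, one_mul, mul_assoc]
        refine mul_le_mul_of_nonneg_left ?_ (by positivity)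
        exact mul_le_mul_of_nonneg_right (Real.sqrt_le_sqrt (RRT.superNormSq_le Ω σ))
          (Real.sqrt_nonneg _)
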